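/- Notation. Nets are indexed by $\varepsilon\in(0,1)$, and "for small $\varepsilon$" means for all $\varepsilon\le\eta$, for some $\eta\in(0,1)$; $\mathbb N$ contains $0$. A net $(x_\varepsilon)_\varepsilon$ of complex numbers is moderate if there is $N\in\mathbb N$ with $|x_\varepsilon|\le\varepsilon^{-N}$ for small $\varepsilon$, and negligible if for every $m\in\mathbb N$, $|x_\varepsilon|\le\varepsilon^{m}$ for small $\varepsilon$. The ring $\widetilde{\mathbb C}$ of Colombeau generalized complex numbers is the quotient of the algebra of moderate nets by the ideal of negligible nets; $[(x_\varepsilon)_\varepsilon]$ is the class of $(x_\varepsilon)_\varepsilon$. For $\tilde z=[(z_\varepsilon)_\varepsilon]\in\widetilde{\mathbb C}$ let $\mathrm v(\tilde z)=\sup\{b\in\mathbb R: |z_\varepsilon|\le\varepsilon^b\text{ for small }\varepsilon\}\in(-\infty,\infty]$, and let $|\tilde z|_{\mathrm e}=e^{-\mathrm v(\tilde z)}\in[0,\infty)$ be the sharp norm. For $\emptyset\neq A\subseteq\widetilde{\mathbb C}$, $\widetilde{\mathcal G}(A)=\mathcal E_M(A)/\mathcal N(A)$, where $\mathcal E_M(A)$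 (resp. $\mathcal N(A)$) is the set of nets $(u_\varepsilon)_\varepsilon$ of functions in $C^\infty(\mathbb R^2,\mathbb C)$ (with $\mathbb R^2\cong\mathbb C$) such that for every $\alpha\in\mathbb N^2$ and every representative $(z_\varepsilon)_\varepsilon$ of every element of $A$, the net $(\partial^\alpha u_\varepsilon(z_\varepsilon))_\varepsilon$ is moderate (resp. negligible). Partial derivatives $\partial_x,\partial_y$ on $\widetilde{\mathcal G}(A)$ are defined on representatives, and $u(\tilde z)=[(u_\varepsilon(z_\varepsilon))_\varepsilon]\in\widetilde{\mathbb C}$ for $u=[(u_\varepsilon)_\varepsilon]\in\widetilde{\mathcal G}(A)$ and $\tilde z=[(z_\varepsilon)_\varepsilon]\in A$. For $A$ open in the topology of the sharp norm, $\widetilde{\mathcal G}_H(A)$ is the set of $u\in\widetilde{\mathcal G}(A)$ with $\bar\partial u=\frac12(\partial_x+i\partial_y)u=0$ in $\widetilde{\mathcal G}(A)$; for such $u$, $Du=\partial_xu=-i\partial_yu$, and $D^k$ is the $k$-th iterate. A generalized zero of $u$ is a $\tilde z\in A$ with $u(\tilde z)=0$. A point $\tilde z_0\in\widetilde{\mathbb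 C}$ is a strict accumulation point of $S\subseteq\widetilde{\mathbb C}$ if for every $s\in\mathbb R$, $s>0$, there is $\tilde z\in S$ such that $\tilde z-\tilde z_0$ is invertible in $\widetilde{\mathbb C}$ and $|\tilde z-\tilde z_0|_{\mathrm e}<s$. Theorem. Let $\tilde z_0\in\widetilde{\mathbb C}$ and let $r>0$ be a real number. Let $A=\{\tilde z\in\widetilde{\mathbb C}: |\tilde z-\tilde z_0|_{\mathrm e}<r\}$ and let $u\in\widetilde{\mathcal G}_H(A)$. Then the following are equivalent: (1) $\tilde z_0$ is a strict accumulation point of the set of generalized zeroes of $u$; (2) $D^ku(\tilde z_0)=0$ for every $k\in\mathbb N$; (3) $u=0$ in $\widetilde{\mathcal G}(A)$. -/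

import Mathlib

open Filter
open scoped ContDiff

noncomputable section

namespace Colombeau

/-- The index set `(0, 1)` of the parameter `ε`. The phrase "for small `ε`" is rendered by
`∀ᶠ ε in atBot`; see `forSmall_iff`. -/
abbrev Eps : Type := Set.Ioo (0 : ℝ) 1

instance : Nonempty Eps := ⟨⟨1 / 2, by norm_num, by norm_num⟩⟩

/-- "For small `ε`" means: for all `ε ≤ η`, for some `η ∈ (0, 1)`. -/
theorem forSmall_iff (P : Eps → Prop) :
    (∀ᶠ ε in atBot, P ε) ↔ ∃ η : Eps, ∀ ε : Eps, ε ≤ η → P ε :=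
  eventually_atBot

theorem Eps.pos (ε : Eps) : 0 < (ε : ℝ) := ε.2.1

theorem Eps.le_one (ε : Eps) : (ε : ℝ) ≤ 1 := ε.2.2.le

theorem eventually_le_half : ∀ᶠ ε : Eps in atBot, (ε : ℝ) ≤ 1 / 2 :=
  eventually_le_atBot (⟨1 / 2, by norm_num, by norm_num⟩ : Eps)

/-! ### Generalized complex numbers -/

/-- Moderate nets of complex numbers. -/
def Moderate (x : Eps → ℂ) : Prop :=
  ∃ N : ℕ, ∀ᶠ ε in atBot, ‖x ε‖ ≤ ((ε : ℝ) ^ N)⁻¹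

/-- Negligible nets of complex numbers. -/
def Negligible (x : Eps → ℂ) : Prop :=
  ∀ m : ℕ, ∀ᶠ ε in atBot, ‖x ε‖ ≤ (ε : ℝ) ^ m

theorem Moderate.add {x y : Eps → ℂ} (hx : Moderate x) (hy : Moderate y) :
    Moderate (fun ε => x ε + y ε) := by
  obtain ⟨N, hN⟩ := hx
  obtain ⟨M, hM⟩ := hy
  refine ⟨N + M + 1, ?_⟩
  filter_upwards [hN, hM, eventually_le_half] with ε h1 h2 h3
  have hp := ε.pos
  have e1 : ((ε : ℝ) ^ N)⁻¹ ≤ ((ε : ℝ) ^ (N + M))⁻¹ :=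
    inv_anti₀ (by positivity) (pow_le_pow_of_le_one hp.le ε.le_one (by omega))
  have e2 : ((ε : ℝ) ^ M)⁻¹ ≤ ((ε : ℝ) ^ (N + M))⁻¹ :=
    inv_anti₀ (by positivity) (pow_le_pow_of_le_one hp.le ε.le_one (by omega))
  have e3 : (2 : ℝ) ≤ (ε : ℝ)⁻¹ := by
    rw [le_inv_comm₀ (by norm_num) hp]; linarith
  have e4 : 0 < ((ε : ℝ) ^ (N + M))⁻¹ := by positivity
  calc ‖x ε + y ε‖ ≤ ‖x ε‖ + ‖y ε‖ := norm_add_le _ _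
    _ ≤ ((ε : ℝ) ^ (N + M))⁻¹ * 2 := by linarith
    _ ≤ ((ε : ℝ) ^ (N + M))⁻¹ * (ε : ℝ)⁻¹ := by gcongr
    _ = ((ε : ℝ) ^ (N + M + 1))⁻¹ := by rw [pow_succ, mul_inv]

theorem Moderate.mul {x y : Eps → ℂ} (hx : Moderate x) (hy : Moderate y) :
    Moderate (fun ε => x ε * y ε) := by
  obtain ⟨N, hN⟩ := hx
  obtain ⟨M, hM⟩ := hy
  refine ⟨N + M, ?_⟩
  filter_upwards [hN, hM] with ε h1 h2
  have hp := ε.pos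
  rw [norm_mul, pow_add, mul_inv]
  gcongr

theorem Negligible.moderate {x : Eps → ℂ} (hx : Negligible x) : Moderate x := by
  refine ⟨0, ?_⟩
  filter_upwards [hx 0] with ε h
  simpa using h

theorem Negligible.add {x y : Eps → ℂ} (hx : Negligible x) (hy : Negligible y) :
    Negligible (fun ε => x ε + y ε) := by
  intro m
  filter_upwards [hx (m + 1), hy (m + 1), eventually_le_half] with ε h1 h2 h3
  have hp : 0 < (ε : ℝ) ^ m := pow_pos ε.pos m
  rw [pow_succ] at h1 h2
  calc ‖x ε + y ε‖ ≤ ‖x ε‖ + ‖y ε‖ := norm_add_le _ _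
    _ ≤ (ε : ℝ) ^ m := by nlinarith

theorem Moderate.mul_negligible {x y : Eps → ℂ} (hx : Moderate x) (hy : Negligible y) :
    Negligible (fun ε => x ε * y ε) := by
  obtain ⟨N, hN⟩ := hx
  intro m
  filter_upwards [hN, hy (N + m)] with ε h1 h2
  have hp := ε.pos
  calc ‖x ε * y ε‖ = ‖x ε‖ * ‖y ε‖ := norm_mul _ _
    _ ≤ ((ε : ℝ) ^ N)⁻¹ * (ε : ℝ) ^ (N + m) := by gcongr
    _ = (ε : ℝ) ^ m := by rw [pow_add]; field_simp

theorem Negligible.of_norm_le {x y : Eps → ℂ} (hy : Negligible y) (h : ∀ ε, ‖x ε‖ ≤ ‖y ε‖) :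
    Negligible x := by
  intro m
  filter_upwards [hy m] with ε h1
  exact (h ε).trans h1

theorem moderate_const (c : ℂ) : Moderate (fun _ => c) := by
  obtain ⟨N, hN⟩ := pow_unbounded_of_one_lt ‖c‖ (one_lt_two)
  refine ⟨N, ?_⟩
  filter_upwards [eventually_le_half] with ε h3
  have hp := ε.pos
  refine hN.le.trans ?_
  rw [← inv_pow]
  gcongr
  rw [le_inv_comm₀ (by norm_num) hp]; linarith

theorem negligible_zero : Negligible (fun _ => 0) := by
  intro m
  filter_upwards with ε
  have hp := ε.pos
  simp only [norm_zero]
  positivity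

/-- The algebra of moderate nets of complex numbers. -/
def moderateNets : Subalgebra ℂ (Eps → ℂ) where
  carrier := {x | Moderate x}
  mul_mem' := fun hx hy => Moderate.mul hx hy
  add_mem' := fun hx hy => Moderate.add hx hy
  algebraMap_mem' := moderate_const

/-- The ideal of negligible nets of complex numbers. -/
def negligibleNets : Ideal moderateNets where
  carrier := {x | Negligible (x : Eps → ℂ)}
  add_mem' := fun hx hy => Negligible.add hx hy
  zero_mem' := negligible_zero
  smul_mem' := fun c _ hx => Moderate.mul_negligible c.2 hx

/-- The ring of Colombeau generalized complex numbers. -/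
abbrev GenComplex : Type := moderateNets ⧸ negligibleNets

/-- The class of a moderate net. -/
abbrev GenComplex.mk (x : moderateNets) : GenComplex := Ideal.Quotient.mk negligibleNets x

/-- A representative of a generalized number. -/
def GenComplex.rep (z : GenComplex) : moderateNets :=
  Function.surjInv Ideal.Quotient.mk_surjective z

theorem GenComplex.mk_rep (z : GenComplex) : GenComplex.mk z.rep = z :=
  Function.surjInv_eq Ideal.Quotient.mk_surjective z

/-! ### Valuation and sharp norm -/

/-- `v(x_ε) = sup {b ∈ ℝ : |x_ε| ≤ ε ^ b for small ε}`. -/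
def netValuation (x : Eps → ℂ) : EReal :=
  sSup ((fun b : ℝ => (b : EReal)) '' {b : ℝ | ∀ᶠ ε in atBot, ‖x ε‖ ≤ (ε : ℝ) ^ b})

theorem netValuation_le {x y : Eps → ℂ} (h : Negligible (fun ε => y ε - x ε)) :
    netValuation x ≤ netValuation y := by
  refine sSup_le ?_
  rintro _ ⟨b, hb, rfl⟩
  refine EReal.ge_of_forall_gt_iff_ge.1 ?_
  intro c hc
  refine le_sSup ⟨c, ?_, rfl⟩
  have hcb : c < b := EReal.coe_lt_coe_iff.1 hc
  obtain ⟨m, hm⟩ := exists_nat_ge b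
  have hlim : ∀ᶠ ε : Eps in atBot, (ε : ℝ) ^ (b - c) ≤ 1 / 2 := by
    have hq : 0 < b - c := sub_pos.2 hcb
    have h0 : (0 : ℝ) < (1 / 2) ^ (1 / (b - c)) := by positivity
    have h1 : ((1 : ℝ) / 2) ^ (1 / (b - c)) < 1 :=
      Real.rpow_lt_one (by norm_num) (by norm_num) (by positivity)
    filter_upwards [eventually_le_atBot (⟨_, h0, h1⟩ : Eps)] with ε hε
    have hε' : (ε : ℝ) ≤ (1 / 2) ^ (1 / (b - c)) := hε
    calc (ε : ℝ) ^ (b - c) ≤ (((1 : ℝ) / 2) ^ (1 / (b - c))) ^ (b - c) :=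
          Real.rpow_le_rpow ε.pos.le hε' hq.le
      _ = 1 / 2 := by
          rw [← Real.rpow_mul (by norm_num), one_div_mul_cancel hq.ne', Real.rpow_one]
  have hb' : ∀ᶠ ε : Eps in atBot, ‖x ε‖ ≤ (ε : ℝ) ^ b := hb
  filter_upwards [hb', h m, hlim] with ε h1 h2 h3
  have hp := ε.pos
  have h4 : (ε : ℝ) ^ m ≤ (ε : ℝ) ^ b := by
    rw [← Real.rpow_natCast]
    exact Real.rpow_le_rpow_of_exponent_ge hp ε.le_one hm
  have h5 : (ε : ℝ) ^ b = (ε : ℝ) ^ c * (ε : ℝ) ^ (b - c) := by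
    rw [← Real.rpow_add hp]; congr 1; ring
  have h6 : 0 < (ε : ℝ) ^ c := Real.rpow_pos_of_pos hp c
  calc ‖y ε‖ = ‖x ε + (y ε - x ε)‖ := by congr 1; ring
    _ ≤ ‖x ε‖ + ‖y ε - x ε‖ := norm_add_le _ _
    _ ≤ (ε : ℝ) ^ c := by nlinarith

/-- The valuation of a generalized number (independent of the representative). -/
def valuation (z : GenComplex) : EReal :=
  Quotient.liftOn' z (fun x : moderateNets => netValuation (x : Eps → ℂ)) (by
    intro x y hxy
    have h : x - y ∈ negligibleNets := (Submodule.quotientRel_def _).1 hxy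
    have h' : y - x ∈ negligibleNets := by simpa using negligibleNets.neg_mem h
    exact le_antisymm (netValuation_le h') (netValuation_le h))

/-- The valuation of a generalized number is never `-∞`. -/
theorem valuation_ne_bot (z : GenComplex) : valuation z ≠ ⊥ := by
  obtain ⟨x, rfl⟩ := Ideal.Quotient.mk_surjective z
  obtain ⟨N, hN⟩ := x.2
  refine ne_bot_of_le_ne_bot (EReal.coe_ne_bot (-(N : ℝ))) (le_sSup ?_)
  refine ⟨-(N : ℝ), ?_, rfl⟩
  change ∀ᶠ ε : Eps in atBot, ‖(x : Eps → ℂ) ε‖ ≤ (ε : ℝ) ^ (-(N : ℝ))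
  filter_upwards [hN] with ε h
  rwa [Real.rpow_neg ε.pos.le, Real.rpow_natCast]

/-- The sharp norm `exp (-v(z))`; it vanishes iff `v(z) = +∞`. The valuation is never `-∞`. -/
def sharpNorm (z : GenComplex) : ℝ := (EReal.exp (-valuation z)).toReal

theorem sharpNorm_zero : sharpNorm 0 = 0 := by
  have h : valuation 0 = ⊤ := by
    refine EReal.eq_top_iff_forall_lt _ |>.2 fun b => ?_
    refine lt_of_lt_of_le (EReal.coe_lt_coe_iff.2 (lt_add_one b)) (le_sSup ⟨b + 1, ?_, rfl⟩)
    change ∀ᶠ ε : Eps in atBot, ‖(0 : ℂ)‖ ≤ (ε : ℝ) ^ (b + 1)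
    filter_upwards with ε
    rw [norm_zero]
    exact Real.rpow_nonneg ε.pos.le _
  simp [sharpNorm, h]

/-- The open ball of real radius `r` for the sharp norm. -/
def sharpBall (z₀ : GenComplex) (r : ℝ) : Set GenComplex := {z | sharpNorm (z - z₀) < r}

theorem center_mem_sharpBall (z₀ : GenComplex) {r : ℝ} (hr : 0 < r) : z₀ ∈ sharpBall z₀ r := by
  simpa [sharpBall, sharpNorm_zero] using hr

/-! ### Partial derivatives of functions on `ℂ ≅ ℝ²` -/

/-- `∂_x f`. -/
def dX (f : ℂ → ℂ) : ℂ → ℂ := fun z => fderiv ℝ f z 1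

/-- `∂_y f`. -/
def dY (f : ℂ → ℂ) : ℂ → ℂ := fun z => fderiv ℝ f z Complex.I

/-- `∂_x ^ a ∂_y ^ b f`. -/
def pDeriv (a b : ℕ) (f : ℂ → ℂ) : ℂ → ℂ := dX^[a] (dY^[b] f)

theorem contDiff_fderiv_apply {f : ℂ → ℂ} (hf : ContDiff ℝ ∞ f) (v : ℂ) :
    ContDiff ℝ ∞ (fun z => fderiv ℝ f z v) :=
  (hf.fderiv_right (m := ∞) (by simp)).clm_apply contDiff_const

theorem contDiff_dX {f : ℂ → ℂ} (hf : ContDiff ℝ ∞ f) : ContDiff ℝ ∞ (dX f) :=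
  contDiff_fderiv_apply hf 1

theorem contDiff_dY {f : ℂ → ℂ} (hf : ContDiff ℝ ∞ f) : ContDiff ℝ ∞ (dY f) :=
  contDiff_fderiv_apply hf Complex.I

theorem differentiable_of_smooth {f : ℂ → ℂ} (hf : ContDiff ℝ ∞ f) : Differentiable ℝ f :=
  hf.differentiable (by simp)

theorem dX_add {f g : ℂ → ℂ} (hf : ContDiff ℝ ∞ f) (hg : ContDiff ℝ ∞ g) :
    dX (f + g) = dX f + dX g := by
  funext z
  simp [dX, fderiv_add (differentiable_of_smooth hf z) (differentiable_of_smooth hg z)]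

theorem dY_add {f g : ℂ → ℂ} (hf : ContDiff ℝ ∞ f) (hg : ContDiff ℝ ∞ g) :
    dY (f + g) = dY f + dY g := by
  funext z
  simp [dY, fderiv_add (differentiable_of_smooth hf z) (differentiable_of_smooth hg z)]

theorem dX_mul {f g : ℂ → ℂ} (hf : ContDiff ℝ ∞ f) (hg : ContDiff ℝ ∞ g) :
    dX (f * g) = f * dX g + g * dX f := by
  funext z
  simp [dX, fderiv_mul (differentiable_of_smooth hf z) (differentiable_of_smooth hg z)]

theorem dY_mul {f g : ℂ → ℂ} (hf : ContDiff ℝ ∞ f) (hg : ContDiff ℝ ∞ g) :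
    dY (f * g) = f * dY g + g * dY f := by
  funext z
  simp [dY, fderiv_mul (differentiable_of_smooth hf z) (differentiable_of_smooth hg z)]

theorem dX_const (c : ℂ) : dX (fun _ => c) = 0 := by
  funext z
  simp [dX]

theorem dY_const (c : ℂ) : dY (fun _ => c) = 0 := by
  funext z
  simp [dY]

theorem dY_dX {f : ℂ → ℂ} (hf : ContDiff ℝ ∞ f) : dY (dX f) = dX (dY f) := by
  funext z
  have hd : DifferentiableAt ℝ (fderiv ℝ f) z :=
    (hf.fderiv_right (m := ∞) (by simp)).differentiable (by simp) z
  have hs : IsSymmSndFDerivAt ℝ f z :=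
    hf.contDiffAt.isSymmSndFDerivAt (by
      rw [minSmoothness_of_isRCLikeNormedField]
      exact ENat.LEInfty.out)
  have key : ∀ v w : ℂ,
      fderiv ℝ (fun t => fderiv ℝ f t v) z w = fderiv ℝ (fderiv ℝ f) z w v := by
    intro v w
    rw [fderiv_clm_apply hd (differentiableAt_const v)]
    simp
  change fderiv ℝ (fun t => fderiv ℝ f t 1) z Complex.I
    = fderiv ℝ (fun t => fderiv ℝ f t Complex.I) z 1
  rw [key, key]
  exact hs.eq _ _

theorem contDiff_dX_iterate (a : ℕ) {f : ℂ → ℂ} (hf : ContDiff ℝ ∞ f) :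
    ContDiff ℝ ∞ (dX^[a] f) := by
  induction a with
  | zero => exact hf
  | succ a ih => rw [Function.iterate_succ_apply']; exact contDiff_dX ih

theorem contDiff_dY_iterate (b : ℕ) {f : ℂ → ℂ} (hf : ContDiff ℝ ∞ f) :
    ContDiff ℝ ∞ (dY^[b] f) := by
  induction b with
  | zero => exact hf
  | succ b ih => rw [Function.iterate_succ_apply']; exact contDiff_dY ih

theorem pDeriv_dY (a b : ℕ) (f : ℂ → ℂ) : pDeriv a b (dY f) = pDeriv a (b + 1) f := rfl

theorem pDeriv_dX (a b : ℕ) {f : ℂ → ℂ} (hf : ContDiff ℝ ∞ f) :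
    pDeriv a b (dX f) = pDeriv (a + 1) b f := by
  have h : dY^[b] (dX f) = dX (dY^[b] f) := by
    induction b with
    | zero => rfl
    | succ b ih =>
      rw [Function.iterate_succ_apply', ih, dY_dX (contDiff_dY_iterate b hf),
        Function.iterate_succ_apply']
  rw [pDeriv, h]
  rfl

theorem pDeriv_add (a b : ℕ) {f g : ℂ → ℂ} (hf : ContDiff ℝ ∞ f) (hg : ContDiff ℝ ∞ g) :
    pDeriv a b (f + g) = pDeriv a b f + pDeriv a b g := by
  have h : dY^[b] (f + g) = dY^[b] f + dY^[b] g := by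
    induction b with
    | zero => rfl
    | succ b ih =>
      simp only [Function.iterate_succ_apply', ih,
        dY_add (contDiff_dY_iterate b hf) (contDiff_dY_iterate b hg)]
  rw [pDeriv, h]
  have hf' := contDiff_dY_iterate b hf
  have hg' := contDiff_dY_iterate b hg
  unfold pDeriv
  induction a with
  | zero => rfl
  | succ a ih =>
    simp only [Function.iterate_succ_apply', ih,
      dX_add (contDiff_dX_iterate a hf') (contDiff_dX_iterate a hg')]

theorem dX_zero : dX 0 = 0 := dX_const 0

theorem dY_zero : dY 0 = 0 := dY_const 0

theorem pDeriv_zero_fun (a b : ℕ) : pDeriv a b 0 = 0 := by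
  have h : dY^[b] 0 = 0 := by
    induction b with
    | zero => rfl
    | succ b ih => rw [Function.iterate_succ_apply', ih, dY_zero]
  rw [pDeriv, h]
  induction a with
  | zero => rfl
  | succ a ih => rw [Function.iterate_succ_apply', ih, dX_zero]

/-! ### The algebra of generalized functions on a set of generalized points -/

/-- The net `u` consists of smooth functions, and for all orders of differentiation `(a, b)` and
every representative `x` of every element of `A`, the net `∂_x ^ a ∂_y ^ b u_ε (x_ε)` has the
property `P`. -/
def SmoothWith (P : (Eps → ℂ) → Prop) (A : Set GenComplex) (u : Eps → ℂ → ℂ) : Prop :=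
  (∀ ε, ContDiff ℝ ∞ (u ε)) ∧
    ∀ (a b : ℕ) (x : moderateNets), GenComplex.mk x ∈ A →
      P (fun ε => pDeriv a b (u ε) ((x : Eps → ℂ) ε))

section

variable {P Q R : (Eps → ℂ) → Prop} {A : Set GenComplex}

theorem SmoothWith.dX {u : Eps → ℂ → ℂ} (hu : SmoothWith P A u) :
    SmoothWith P A (fun ε => dX (u ε)) := by
  refine ⟨fun ε => contDiff_dX (hu.1 ε), fun a b x hx => ?_⟩
  have h := hu.2 (a + 1) b x hx
  simpa only [pDeriv_dX a b (hu.1 _)] using h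

theorem SmoothWith.dY {u : Eps → ℂ → ℂ} (hu : SmoothWith P A u) :
    SmoothWith P A (fun ε => dY (u ε)) :=
  ⟨fun ε => contDiff_dY (hu.1 ε), fun a b x hx => hu.2 a (b + 1) x hx⟩

theorem SmoothWith.add
    (hP : ∀ x y : Eps → ℂ, P x → P y → P (fun ε => x ε + y ε))
    {u v : Eps → ℂ → ℂ} (hu : SmoothWith P A u) (hv : SmoothWith P A v) :
    SmoothWith P A (u + v) := by
  refine ⟨fun ε => (hu.1 ε).add (hv.1 ε), fun a b x hx => ?_⟩
  have h := hP _ _ (hu.2 a b x hx) (hv.2 a b x hx)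
  have e : ∀ ε, pDeriv a b ((u + v) ε) = pDeriv a b (u ε) + pDeriv a b (v ε) :=
    fun ε => pDeriv_add a b (hu.1 ε) (hv.1 ε)
  simp only [e]
  exact h

theorem SmoothWith.mul
    (hR : ∀ x y : Eps → ℂ, R x → R y → R (fun ε => x ε + y ε))
    (hPQ : ∀ x y : Eps → ℂ, P x → Q y → R (fun ε => x ε * y ε))
    {u v : Eps → ℂ → ℂ} (hu : SmoothWith P A u) (hv : SmoothWith Q A v) :
    SmoothWith R A (u * v) := by
  refine ⟨fun ε => (hu.1 ε).mul (hv.1 ε), fun a b x hx => ?_⟩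
  induction a generalizing u v with
  | zero =>
    induction b generalizing u v with
    | zero => exact hPQ _ _ (hu.2 0 0 x hx) (hv.2 0 0 x hx)
    | succ b ih =>
      have e : ∀ ε, pDeriv 0 (b + 1) ((u * v) ε)
          = pDeriv 0 b (u ε * Colombeau.dY (v ε)) + pDeriv 0 b (Colombeau.dY (u ε) * v ε) := by
        intro ε
        rw [← pDeriv_dY, Pi.mul_apply, dY_mul (hu.1 ε) (hv.1 ε), mul_comm (v ε),
          pDeriv_add 0 b (f := u ε * Colombeau.dY (v ε))
            (g := Colombeau.dY (u ε) * v ε) ((hu.1 ε).mul (contDiff_dY (hv.1 ε)))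
            ((contDiff_dY (hu.1 ε)).mul (hv.1 ε))]
      simp only [e, Pi.add_apply]
      exact hR _ _ (ih hu hv.dY) (ih hu.dY hv)
  | succ a ih =>
    have e : ∀ ε, pDeriv (a + 1) b ((u * v) ε)
        = pDeriv a b (u ε * Colombeau.dX (v ε)) + pDeriv a b (Colombeau.dX (u ε) * v ε) := by
      intro ε
      rw [← pDeriv_dX a b (f := (u * v) ε) ((hu.1 ε).mul (hv.1 ε)), Pi.mul_apply,
        dX_mul (hu.1 ε) (hv.1 ε), mul_comm (v ε),
        pDeriv_add a b (f := u ε * Colombeau.dX (v ε))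
            (g := Colombeau.dX (u ε) * v ε) ((hu.1 ε).mul (contDiff_dX (hv.1 ε)))
          ((contDiff_dX (hu.1 ε)).mul (hv.1 ε))]
    simp only [e, Pi.add_apply]
    exact hR _ _ (ih hu hv.dX) (ih hu.dX hv)

theorem smoothWith_const (c : ℂ) : SmoothWith Moderate A (fun _ _ => c) := by
  refine ⟨fun _ => contDiff_const, fun a b x _ => ?_⟩
  rcases b with _ | b
  · rcases a with _ | a
    · exact moderate_const c
    · have h : pDeriv (a + 1) 0 (fun _ : ℂ => c) = 0 := by
        rw [← pDeriv_dX a 0 contDiff_const, dX_const, pDeriv_zero_fun]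
      simp only [h]
      exact negligible_zero.moderate
  · have h : pDeriv a (b + 1) (fun _ : ℂ => c) = 0 := by
      rw [← pDeriv_dY, dY_const, pDeriv_zero_fun]
    simp only [h]
    exact negligible_zero.moderate

end

/-- The algebra of nets of smooth functions that are moderate on `A`. -/
def moderateFunctions (A : Set GenComplex) : Subalgebra ℂ (Eps → ℂ → ℂ) where
  carrier := {u | SmoothWith Moderate A u}
  mul_mem' := fun hu hv =>
    SmoothWith.mul (fun _ _ => Moderate.add) (fun _ _ => Moderate.mul) hu hv
  add_mem' := fun hu hv => SmoothWith.add (fun _ _ => Moderate.add) hu hv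
  algebraMap_mem' := fun c => smoothWith_const c

/-- The ideal of nets of smooth functions that are negligible on `A`. -/
def negligibleFunctions (A : Set GenComplex) : Ideal (moderateFunctions A) where
  carrier := {u | SmoothWith Negligible A (u : Eps → ℂ → ℂ)}
  add_mem' := fun hu hv => SmoothWith.add (fun _ _ => Negligible.add) hu hv
  zero_mem' := ⟨fun _ => contDiff_const, fun a b x _ => by
    have h : ∀ ε : Eps, pDeriv a b (((0 : moderateFunctions A) : Eps → ℂ → ℂ) ε) = 0 :=
      fun _ => pDeriv_zero_fun a b
    simp only [h]
    exact negligible_zero⟩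
  smul_mem' := fun c _ hu =>
    SmoothWith.mul (fun _ _ => Negligible.add) (fun _ _ => Moderate.mul_negligible) c.2 hu

/-- The algebra of generalized functions on `A`. -/
abbrev GenFun (A : Set GenComplex) : Type := moderateFunctions A ⧸ negligibleFunctions A

/-! ### Point values -/

/-- A moderate net of functions evaluated along a representative of a point of `A`. -/
def evalNet {A : Set GenComplex} (x : moderateNets) (hx : GenComplex.mk x ∈ A) :
    moderateFunctions A →ₐ[ℂ] moderateNets where
  toFun u := ⟨fun ε => (u : Eps → ℂ → ℂ) ε ((x : Eps → ℂ) ε), u.2.2 0 0 x hx⟩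
  map_one' := rfl
  map_mul' _ _ := rfl
  map_zero' := rfl
  map_add' _ _ := rfl
  commutes' _ := rfl

/-- The point value `u(z)` of a generalized function `u` on `A` at `z ∈ A`, as an algebra
homomorphism in `u`. By `pointValue_mk` it is the class of `u_ε(x_ε)` for all representatives
of `u` and of `z`. -/
def pointValue {A : Set GenComplex} (z : A) : GenFun A →ₐ[ℂ] GenComplex :=
  Ideal.Quotient.liftₐ (negligibleFunctions A)
    ((Ideal.Quotient.mkₐ ℂ negligibleNets).comp
      (evalNet z.1.rep (z.1.mk_rep.symm ▸ z.2)))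
    (fun _ hu => Ideal.Quotient.eq_zero_iff_mem.2 (hu.2 0 0 z.1.rep (z.1.mk_rep.symm ▸ z.2)))

theorem norm_fderiv_le (f : ℂ → ℂ) (z : ℂ) : ‖fderiv ℝ f z‖ ≤ ‖dX f z‖ + ‖dY f z‖ := by
  refine ContinuousLinearMap.opNorm_le_bound _ (by positivity) fun w => ?_
  have hw : w = w.re • (1 : ℂ) + w.im • Complex.I := by
    apply Complex.ext <;> simp
  have h : fderiv ℝ f z w = w.re • dX f z + w.im • dY f z := by
    conv_lhs => rw [hw]
    rw [map_add, map_smul, map_smul]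
    rfl
  rw [h]
  have h1 := Complex.abs_re_le_norm w
  have h2 := Complex.abs_im_le_norm w
  calc ‖w.re • dX f z + w.im • dY f z‖ ≤ |w.re| * ‖dX f z‖ + |w.im| * ‖dY f z‖ := by
        refine (norm_add_le _ _).trans (le_of_eq ?_)
        rw [norm_smul, norm_smul, Real.norm_eq_abs, Real.norm_eq_abs]
    _ ≤ ‖w‖ * ‖dX f z‖ + ‖w‖ * ‖dY f z‖ := by gcongr
    _ = (‖dX f z‖ + ‖dY f z‖) * ‖w‖ := by ring

theorem exists_mean_value {f : ℂ → ℂ} (hf : ContDiff ℝ ∞ f) (x y : ℂ) :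
    ∃ w : ℂ, ‖w - x‖ ≤ ‖y - x‖ ∧ ‖f y - f x‖ ≤ (‖dX f w‖ + ‖dY f w‖) * ‖y - x‖ := by
  have hne : (Metric.closedBall x ‖y - x‖).Nonempty := ⟨x, by simp⟩
  obtain ⟨w, hw, hmax⟩ := (isCompact_closedBall x ‖y - x‖).exists_isMaxOn hne
    (hf.continuous_fderiv (by simp)).norm.continuousOn
  refine ⟨w, by simpa [dist_eq_norm] using hw, ?_⟩
  refine ((convex_closedBall x ‖y - x‖).norm_image_sub_le_of_norm_fderiv_le (𝕜 := ℝ)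
    (fun t _ => differentiable_of_smooth hf t) (fun t ht => hmax ht)
    (by simp) (by simp [dist_eq_norm])).trans ?_
  gcongr
  exact norm_fderiv_le f w

/-- Values along two representatives of the same point of `A` differ by a negligible net. -/
theorem negligible_sub_of_eq {A : Set GenComplex} (u : moderateFunctions A) (x y : moderateNets)
    (hx : GenComplex.mk x ∈ A) (hxy : GenComplex.mk y = GenComplex.mk x) :
    Negligible (fun ε => (u : Eps → ℂ → ℂ) ε ((y : Eps → ℂ) ε)
      - (u : Eps → ℂ → ℂ) ε ((x : Eps → ℂ) ε)) := by
  have hn : Negligible (fun ε => (y : Eps → ℂ) ε - (x : Eps → ℂ) ε) := Ideal.Quotient.eq.1 hxy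
  choose w hw1 hw2 using fun ε => exists_mean_value (u.2.1 ε) ((x : Eps → ℂ) ε) ((y : Eps → ℂ) ε)
  have hwn : Negligible (fun ε => w ε - (x : Eps → ℂ) ε) := hn.of_norm_le hw1
  have hwm : Moderate w := by
    have h := Moderate.add hwn.moderate x.2
    simpa using h
  have hmk : GenComplex.mk ⟨w, hwm⟩ = GenComplex.mk x := Ideal.Quotient.eq.2 hwn
  have hA : GenComplex.mk ⟨w, hwm⟩ ∈ A := hmk ▸ hx
  have m1 : Moderate (fun ε => ((‖dX ((u : Eps → ℂ → ℂ) ε) (w ε)‖ : ℝ) : ℂ)) := by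
    obtain ⟨N, hN⟩ := u.2.2 1 0 ⟨w, hwm⟩ hA
    refine ⟨N, ?_⟩
    filter_upwards [hN] with ε h
    rw [Complex.norm_real, norm_norm]
    exact h
  have m2 : Moderate (fun ε => ((‖dY ((u : Eps → ℂ → ℂ) ε) (w ε)‖ : ℝ) : ℂ)) := by
    obtain ⟨N, hN⟩ := u.2.2 0 1 ⟨w, hwm⟩ hA
    refine ⟨N, ?_⟩
    filter_upwards [hN] with ε h
    rw [Complex.norm_real, norm_norm]
    exact h
  refine ((m1.add m2).mul_negligible hn).of_norm_le fun ε => ?_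
  refine (hw2 ε).trans (le_of_eq ?_)
  rw [norm_mul, ← Complex.ofReal_add, Complex.norm_real, Real.norm_of_nonneg (by positivity)]

/-- Point values are independent of the representatives. -/
theorem pointValue_mk {A : Set GenComplex} (u : moderateFunctions A) (x : moderateNets)
    (hx : GenComplex.mk x ∈ A) :
    pointValue ⟨GenComplex.mk x, hx⟩ (Ideal.Quotient.mk (negligibleFunctions A) u)
      = GenComplex.mk (evalNet x hx u) :=
  Ideal.Quotient.eq.2 (negligible_sub_of_eq u x _ hx (GenComplex.mk x).mk_rep)

/-! ### Derivatives and holomorphy -/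

/-- `∂_x` on representatives. -/
def moderateDX (A : Set GenComplex) : moderateFunctions A →ₗ[ℂ] moderateFunctions A where
  toFun u := ⟨fun ε => dX ((u : Eps → ℂ → ℂ) ε), SmoothWith.dX u.2⟩
  map_add' u v := Subtype.ext (funext fun ε => dX_add (u.2.1 ε) (v.2.1 ε))
  map_smul' c u := Subtype.ext (funext fun ε => funext fun z => by
    have h := fderiv_const_smul (differentiable_of_smooth (u.2.1 ε) z) c
    exact congrArg (fun L : ℂ →L[ℝ] ℂ => L 1) h)

/-- `∂_y` on representatives. -/
def moderateDY (A : Set GenComplex) : moderateFunctions A →ₗ[ℂ] moderateFunctions A where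
  toFun u := ⟨fun ε => dY ((u : Eps → ℂ → ℂ) ε), SmoothWith.dY u.2⟩
  map_add' u v := Subtype.ext (funext fun ε => dY_add (u.2.1 ε) (v.2.1 ε))
  map_smul' c u := Subtype.ext (funext fun ε => funext fun z => by
    have h := fderiv_const_smul (differentiable_of_smooth (u.2.1 ε) z) c
    exact congrArg (fun L : ℂ →L[ℝ] ℂ => L Complex.I) h)

/-- The operator `∂_x` on the algebra of generalized functions on `A`. -/
def partialX (A : Set GenComplex) : GenFun A →ₗ[ℂ] GenFun A :=
  Submodule.mapQ ((negligibleFunctions A).restrictScalars ℂ)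
    ((negligibleFunctions A).restrictScalars ℂ) (moderateDX A)
    (fun _ hu => SmoothWith.dX hu)

/-- The operator `∂_y` on the algebra of generalized functions on `A`. -/
def partialY (A : Set GenComplex) : GenFun A →ₗ[ℂ] GenFun A :=
  Submodule.mapQ ((negligibleFunctions A).restrictScalars ℂ)
    ((negligibleFunctions A).restrictScalars ℂ) (moderateDY A)
    (fun _ hu => SmoothWith.dY hu)

/-- `∂̄ = (∂_x + i ∂_y) / 2`. -/
def dBar (A : Set GenComplex) : GenFun A →ₗ[ℂ] GenFun A :=
  (1 / 2 : ℂ) • (partialX A + Complex.I • partialY A)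

/-- The generalized holomorphic functions on `A`: those `u` with `∂̄ u = 0`. -/
def genHolomorphic (A : Set GenComplex) : Submodule ℂ (GenFun A) := LinearMap.ker (dBar A)

/-- On generalized holomorphic functions, `∂_x u = -i ∂_y u`. -/
theorem partialX_eq {A : Set GenComplex} {u : GenFun A} (hu : u ∈ genHolomorphic A) :
    partialX A u = -Complex.I • partialY A u := by
  have h : (1 / 2 : ℂ) • (partialX A u + Complex.I • partialY A u) = 0 := hu
  have h2 : partialX A u + Complex.I • partialY A u = 0 := by
    have h3 := congrArg (fun t => (2 : ℂ) • t) h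
    simpa only [smul_smul, smul_zero, mul_one_div_cancel (two_ne_zero' ℂ), one_smul] using h3
  rw [neg_smul]
  exact eq_neg_of_add_eq_zero_left h2

/-- The iterated derivative `D ^ k u`, where `D u = u' = ∂_x u` (for `u` holomorphic). -/
def iterDeriv {A : Set GenComplex} (k : ℕ) (u : GenFun A) : GenFun A := (partialX A)^[k] u

/-- The set of generalized zeroes of `u` in `A`. -/
def zeroes {A : Set GenComplex} (u : GenFun A) : Set GenComplex :=
  {z | ∃ hz : z ∈ A, pointValue ⟨z, hz⟩ u = 0}

/-- `z₀` is a strict accumulation point of `S`. -/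
def IsStrictAccumulationPoint (z₀ : GenComplex) (S : Set GenComplex) : Prop :=
  ∀ r : ℝ, 0 < r → ∃ z ∈ S, IsUnit (z - z₀) ∧ sharpNorm (z - z₀) < r

end Colombeau

end

namespace Colombeau

open intervalIntegral

/-! ### Almost holomorphic functions on a disc -/

/-! A representative `f` of a generalized holomorphic function satisfies the Cauchy–Riemann equation
only up to a negligible error, so the classical tools (mean value property, Cauchy estimate,
Taylor's formula) are proved for one smooth function with an explicit defect `δ` bounding
`cauchyRiemann`. A point of the sharp ball has representatives in the discs of radius `ε ^ b` about
the center, for some `b > -log r`. On such a disc `exists_maximizing_net` turns moderateness or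
negligibility along nets of points into a uniform bound, so `δ` can be taken to be any power of `ε`.

Vanishing derivatives force `u = 0` by a count of exponents, in `uniformBound_of_center`. By
Cauchy's estimate the `n`-th derivative is at most `ε ^ (p - n * b₂)`, with `p` independent of `n`.
Integrating it back `n` times from the center, where all derivatives are negligible, gains `n * b₃`.
With `b₂ < b₃ < b` the net gain `n * (b₃ - b₂)` exceeds any power, whatever the sign of `b`. The
`y`-derivatives then follow from the Cauchy–Riemann equation (`smoothWith_negligible`).

Accumulating zeroes force the derivatives to vanish by induction on the order `k`, in
`negligible_dX_iterate_center`. At a zero `x` close to the center `c`, Taylor's formula leaves only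
the term of order `k` and a remainder of order `k + 1`. Invertibility of `x - c` bounds `|x - c|`
below by a power of `ε`, so one may divide by `|x - c| ^ k`. Finally, if `u = 0`, every point of the
ball is a zero, and the points `c + ε ^ n` accumulate strictly at `c`. -/

/-- The Cauchy–Riemann operator `∂_x + i ∂_y`. -/
noncomputable def cauchyRiemann (f : ℂ → ℂ) : ℂ → ℂ := fun z => dX f z + Complex.I * dY f z

/-- The differential is split into its value on a complex-linear function and a defect proportional
to `cauchyRiemann f`. Every estimate below treats the first term classically and the second as an
error. -/
theorem fderiv_apply_eq (f : ℂ → ℂ) (z v : ℂ) :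
    fderiv ℝ f z v = v * dX f z - Complex.I * v.im * cauchyRiemann f z := by
  have hv : v = v.re • (1 : ℂ) + v.im • Complex.I := by
    apply Complex.ext <;> simp
  have h : fderiv ℝ f z v = v.re • dX f z + v.im • dY f z := by
    conv_lhs => rw [hv]
    rw [map_add, map_smul, map_smul]
    rfl
  rw [h, cauchyRiemann, Complex.real_smul, Complex.real_smul]
  nth_rewrite 3 [← Complex.re_add_im v]
  linear_combination ((v.im : ℂ) * dY f z) * Complex.I_sq

theorem continuous_cauchyRiemann {f : ℂ → ℂ} (hf : ContDiff ℝ ∞ f) :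
    Continuous (cauchyRiemann f) :=
  (contDiff_dX hf).continuous.add (continuous_const.mul (contDiff_dY hf).continuous)

/-- Fundamental theorem of calculus in `t`, then Fubini: only the angular integral of `K' t` has to
be bounded, for each fixed `t`. Leaving out `t = 0` matters, since the application to the mean value
property divides by `t`. -/
theorem norm_integral_sub_le {K K' : ℝ → ℝ → ℂ} {a b B : ℝ}
    (hK' : Continuous (Function.uncurry K'))
    (hK : ∀ t θ, HasDerivAt (fun s => K s θ) (K' t θ) t)
    (hB : ∀ t ∈ Set.Ioc (0 : ℝ) 1, ‖∫ θ in a..b, K' t θ‖ ≤ B) :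
    ‖∫ θ in a..b, (K 1 θ - K 0 θ)‖ ≤ B := by
  have h1 : ∀ θ, K 1 θ - K 0 θ = ∫ t in (0 : ℝ)..1, K' t θ := fun θ =>
    (integral_eq_sub_of_hasDerivAt (fun t _ => hK t θ)
      ((hK'.comp (Continuous.prodMk_left θ)).intervalIntegrable _ _)).symm
  simp only [h1]
  rw [MeasureTheory.intervalIntegral_intervalIntegral_swap]
  swap
  · exact ((hK'.comp continuous_swap).integrableOn_Icc (μ := MeasureTheory.volume)
      (a := ((min a b, 0) : ℝ × ℝ)) (b := (max a b, 1))).mono_set (by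
        rintro ⟨x, y⟩ ⟨hx, hy⟩
        rw [Set.uIoc_of_le zero_le_one] at hy
        exact ⟨⟨hx.1.le, hy.1.le⟩, ⟨hx.2, hy.2⟩⟩)
  refine (norm_integral_le_of_norm_le_const (C := B) fun t ht => hB t ?_).trans (by simp)
  rwa [Set.uIoc_of_le zero_le_one] at ht

theorem hasDerivAt_comp_fderiv {f : ℂ → ℂ} (hf : ContDiff ℝ ∞ f) {γ : ℝ → ℂ} {γ' : ℂ} {t : ℝ}
    (hγ : HasDerivAt γ γ' t) : HasDerivAt (fun s => f (γ s)) (fderiv ℝ f (γ t) γ') t :=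
  (differentiable_of_smooth hf (γ t)).hasFDerivAt.comp_hasDerivAt t hγ

theorem hasDerivAt_add_ofReal_mul (c w : ℂ) (t : ℝ) :
    HasDerivAt (fun s : ℝ => c + s * w) w t := by
  simpa using ((hasDerivAt_id t).ofReal_comp.mul_const w).const_add c

theorem hasDerivAt_circle (θ : ℝ) :
    HasDerivAt (fun s : ℝ => Complex.exp (s * Complex.I))
      (Complex.I * Complex.exp (θ * Complex.I)) θ := by
  have h := ((hasDerivAt_id θ).ofReal_comp.mul_const Complex.I).cexp
  simpa [mul_comm] using h

theorem norm_circle_le {c : ℂ} {R t : ℝ} (ht : t ∈ Set.Icc (0 : ℝ) 1) (hR : 0 ≤ R) (θ : ℝ) :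
    ‖c + t * (R * Complex.exp (θ * Complex.I)) - c‖ ≤ R := by
  rw [add_sub_cancel_left, norm_mul, norm_mul, Complex.norm_exp_ofReal_mul_I, mul_one,
    Complex.norm_real, Complex.norm_real, Real.norm_of_nonneg ht.1, Real.norm_of_nonneg hR]
  exact mul_le_of_le_one_left hR ht.2

/-- The mean value property of almost holomorphic functions. -/
theorem norm_integral_circle_sub_le {g : ℂ → ℂ} (hg : ContDiff ℝ ∞ g) {c : ℂ} {R δ : ℝ}
    (hR : 0 ≤ R) (hδ : ∀ z, ‖z - c‖ ≤ R → ‖cauchyRiemann g z‖ ≤ δ) :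
    ‖∫ θ in (0 : ℝ)..2 * Real.pi, (g (c + R * Complex.exp (θ * Complex.I)) - g c)‖
      ≤ R * δ * (2 * Real.pi) := by
  have hcont : Continuous fun p : ℝ × ℝ => c + p.1 * (R * Complex.exp (p.2 * Complex.I)) := by
    fun_prop
  have hfd : Continuous (fderiv ℝ g) := hg.continuous_fderiv (by simp)
  -- Radial homotopy contracting the circle of radius `R` to its center.
  have hK := norm_integral_sub_le (a := 0) (b := 2 * Real.pi) (B := R * δ * (2 * Real.pi))
    (K := fun t θ => g (c + t * (R * Complex.exp (θ * Complex.I))))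
    (K' := fun t θ => fderiv ℝ g (c + t * (R * Complex.exp (θ * Complex.I)))
      (R * Complex.exp (θ * Complex.I)))
    ((hfd.comp hcont).clm_apply (by fun_prop))
    (fun t θ => hasDerivAt_comp_fderiv hg (hasDerivAt_add_ofReal_mul c _ t)) ?_
  · simpa using hK
  intro t ht
  have hcont_t : Continuous fun θ : ℝ => c + t * (R * Complex.exp (θ * Complex.I)) := by
    fun_prop
  -- The integrand is the `θ`-derivative of `g` along the circle of radius `t * R`, a periodic
  -- function.
  have hzero : ∫ θ in (0 : ℝ)..2 * Real.pi,
      fderiv ℝ g (c + t * (R * Complex.exp (θ * Complex.I)))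
        (t * (R * (Complex.I * Complex.exp (θ * Complex.I)))) = 0 := by
    rw [integral_eq_sub_of_hasDerivAt
      (f := fun θ : ℝ => g (c + t * (R * Complex.exp (θ * Complex.I))))
      (fun θ _ => hasDerivAt_comp_fderiv hg
        ((((hasDerivAt_circle θ).const_mul (R : ℂ)).const_mul (t : ℂ)).const_add c))
      (((hfd.comp hcont_t).clm_apply (by fun_prop)).intervalIntegrable _ _)]
    simp
  have ht0 : (t : ℂ) ≠ 0 := by exact_mod_cast ht.1.ne'
  -- The tangent vector is `t * I` times the radial one. If `g` were holomorphic, the radial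
  -- derivative would therefore be `-I / t` times the angular one; the Cauchy–Riemann term is the
  -- failure of this.
  have hpt : ∀ θ : ℝ, fderiv ℝ g (c + t * (R * Complex.exp (θ * Complex.I)))
        (R * Complex.exp (θ * Complex.I))
      = R * Complex.exp (-(θ * Complex.I))
          * cauchyRiemann g (c + t * (R * Complex.exp (θ * Complex.I)))
        + (-Complex.I / t) * fderiv ℝ g (c + t * (R * Complex.exp (θ * Complex.I)))
          (t * (R * (Complex.I * Complex.exp (θ * Complex.I)))) := by
    intro θ
    have e1 : ((R : ℂ) * Complex.exp (θ * Complex.I)).im = R * Real.sin θ := by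
      rw [Complex.im_ofReal_mul, Complex.exp_ofReal_mul_I_im]
    have e2 : ((t : ℂ) * (R * (Complex.I * Complex.exp (θ * Complex.I)))).im
        = t * (R * Real.cos θ) := by
      rw [Complex.im_ofReal_mul, Complex.im_ofReal_mul, Complex.I_mul_im,
        Complex.exp_ofReal_mul_I_re]
    rw [fderiv_apply_eq, fderiv_apply_eq g _ (t * _), e1, e2, ← neg_mul, Complex.exp_mul_I,
      Complex.exp_mul_I, Complex.cos_neg, Complex.sin_neg]
    push_cast
    field_simp
    ring_nf
    simp only [Complex.I_sq, Complex.I_pow_three]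
    ring
  simp only [hpt]
  have hE := continuous_cauchyRiemann hg
  rw [integral_add, intervalIntegral.integral_const_mul, hzero, mul_zero, add_zero]
  · refine (norm_integral_le_of_norm_le_const (C := R * δ) fun θ _ => ?_).trans ?_
    · rw [norm_mul, norm_mul, ← neg_mul, ← Complex.ofReal_neg, Complex.norm_exp_ofReal_mul_I,
        Complex.norm_real, Real.norm_of_nonneg hR, mul_one]
      exact mul_le_mul_of_nonneg_left
        (hδ _ (norm_circle_le ⟨ht.1.le, ht.2⟩ hR θ)) hR
    · rw [sub_zero, abs_of_pos Real.two_pi_pos]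
  · exact Continuous.intervalIntegrable (by fun_prop) _ _
  · exact (continuous_const.mul
      ((hfd.comp hcont_t).clm_apply (by fun_prop))).intervalIntegrable _ _

/-- The Cauchy estimate for the derivative of an almost holomorphic function. -/
theorem cauchy_estimate {f : ℂ → ℂ} (hf : ContDiff ℝ ∞ f) {c : ℂ} {R M δ : ℝ} (hR : 0 ≤ R)
    (hM : ∀ z, ‖z - c‖ ≤ R → ‖f z‖ ≤ M)
    (hδ : ∀ z, ‖z - c‖ ≤ R → ‖cauchyRiemann f z‖ ≤ δ)
    (hδ' : ∀ z, ‖z - c‖ ≤ R → ‖cauchyRiemann (dX f) z‖ ≤ δ) :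
    R * ‖dX f c‖ ≤ M + R * δ + R ^ 2 * δ := by
  have hδ0 : 0 ≤ δ := (norm_nonneg _).trans (hδ c (by simpa using hR))
  have hfd : Continuous (fderiv ℝ f) := hf.continuous_fderiv (by simp)
  have hdx : Continuous (dX f) := (contDiff_dX hf).continuous
  have hE := continuous_cauchyRiemann hf
  have hcont : Continuous fun p : ℝ × ℝ => c + p.1 * (R * Complex.exp (p.2 * Complex.I)) := by
    fun_prop
  -- The weight `exp (-θ * I)` extracts the first Fourier coefficient on the circle. Subtracting `t
  -- * R * dX f c` removes its expected value, so that the `t`-derivative of `K` is small.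
  have hK := norm_integral_sub_le (a := 0) (b := 2 * Real.pi)
    (B := R * δ * (2 * Real.pi) + R * (R * δ * (2 * Real.pi)))
    (K := fun t θ => f (c + t * (R * Complex.exp (θ * Complex.I))) * Complex.exp (-θ * Complex.I)
      - t * (R * dX f c))
    (K' := fun t θ => fderiv ℝ f (c + t * (R * Complex.exp (θ * Complex.I)))
      (R * Complex.exp (θ * Complex.I)) * Complex.exp (-θ * Complex.I) - R * dX f c)
    ((((hfd.comp hcont).clm_apply (by fun_prop)).mul (by fun_prop)).sub continuous_const)
    (fun t θ => ((hasDerivAt_comp_fderiv hf (hasDerivAt_add_ofReal_mul c _ t)).mul_const _).sub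
      (by simpa using hasDerivAt_add_ofReal_mul 0 ((R : ℂ) * dX f c) t)) ?_
  · have hexp : ∫ θ in (0 : ℝ)..2 * Real.pi, f c * Complex.exp (-θ * Complex.I) = 0 := by
      rw [intervalIntegral.integral_const_mul]
      have h := integral_exp_mul_complex (a := 0) (b := 2 * Real.pi) (c := -Complex.I) (by simp)
      have e : ∀ θ : ℝ, Complex.exp (-θ * Complex.I) = Complex.exp (-Complex.I * θ) :=
        fun θ => by congr 1; ring
      simp only [e, h]
      have : Complex.exp (-Complex.I * (2 * Real.pi : ℝ)) = 1 := by
        rw [Complex.exp_eq_one_iff]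
        exact ⟨-1, by push_cast; ring⟩
      rw [this]
      simp
    have hsplit : ∫ θ in (0 : ℝ)..2 * Real.pi,
        ((f (c + (1 : ℝ) * (R * Complex.exp (θ * Complex.I))) * Complex.exp (-θ * Complex.I)
          - (1 : ℝ) * (R * dX f c))
        - (f (c + (0 : ℝ) * (R * Complex.exp (θ * Complex.I))) * Complex.exp (-θ * Complex.I)
          - (0 : ℝ) * (R * dX f c)))
        = (∫ θ in (0 : ℝ)..2 * Real.pi,
          f (c + (1 : ℝ) * (R * Complex.exp (θ * Complex.I))) * Complex.exp (-θ * Complex.I))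
          - 2 * Real.pi * (R * dX f c) := by
      have hc1 : Continuous fun θ : ℝ =>
          f (c + (1 : ℝ) * (R * Complex.exp (θ * Complex.I))) * Complex.exp (-θ * Complex.I) :=
        (hf.continuous.comp (by fun_prop)).mul (by fun_prop)
      have hc2 : Continuous fun θ : ℝ => f c * Complex.exp (-θ * Complex.I) := by fun_prop
      have e : ∀ θ : ℝ,
          ((f (c + (1 : ℝ) * (R * Complex.exp (θ * Complex.I))) * Complex.exp (-θ * Complex.I)
            - (1 : ℝ) * (R * dX f c))
          - (f (c + (0 : ℝ) * (R * Complex.exp (θ * Complex.I))) * Complex.exp (-θ * Complex.I)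
            - (0 : ℝ) * (R * dX f c)))
          = f (c + (1 : ℝ) * (R * Complex.exp (θ * Complex.I))) * Complex.exp (-θ * Complex.I)
            - R * dX f c - f c * Complex.exp (-θ * Complex.I) := by
        intro θ; simp
      simp only [e]
      rw [integral_sub (f := fun θ : ℝ => f (c + (1 : ℝ) * (R * Complex.exp (θ * Complex.I)))
          * Complex.exp (-θ * Complex.I) - R * dX f c) ((hc1.sub continuous_const).intervalIntegrable _ _)
        (hc2.intervalIntegrable _ _), hexp, sub_zero,
        integral_sub (hc1.intervalIntegrable _ _) intervalIntegrable_const]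
      simp
      ring
    rw [hsplit] at hK
    have hI : ‖∫ θ in (0 : ℝ)..2 * Real.pi,
        f (c + (1 : ℝ) * (R * Complex.exp (θ * Complex.I))) * Complex.exp (-θ * Complex.I)‖
        ≤ M * (2 * Real.pi) := by
      refine (norm_integral_le_of_norm_le_const (C := M) fun θ _ => ?_).trans ?_
      · rw [norm_mul, ← Complex.ofReal_neg, Complex.norm_exp_ofReal_mul_I, mul_one]
        exact hM _ (norm_circle_le ⟨zero_le_one, le_rfl⟩ hR θ)
      · rw [sub_zero, abs_of_pos Real.two_pi_pos]
    have hn : ‖2 * Real.pi * (R * dX f c)‖ = 2 * Real.pi * (R * ‖dX f c‖) := by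
      rw [norm_mul, norm_mul, norm_mul, Complex.norm_real, Complex.norm_real,
        Real.norm_of_nonneg hR, Real.norm_of_nonneg Real.pi_pos.le]
      simp
    have htri := (norm_sub_norm_le _ _).trans ((norm_sub_rev _ _).le.trans hK)
    rw [hn] at htri
    have hpi := Real.two_pi_pos
    refine le_of_mul_le_mul_left ?_ hpi
    nlinarith
  intro t ht
  have htR : 0 ≤ t * R := mul_nonneg ht.1.le hR
  have htR' : t * R ≤ R := mul_le_of_le_one_left hR ht.2
  -- The weight cancels the direction `exp (θ * I)` in the complex-linear part. What remains is a
  -- Cauchy–Riemann error and the deviation of `dX f` from its value at `c`, to which the mean value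
  -- property applies on radius `t * R`.
  have hpt : ∀ θ : ℝ, fderiv ℝ f (c + t * (R * Complex.exp (θ * Complex.I)))
        (R * Complex.exp (θ * Complex.I)) * Complex.exp (-θ * Complex.I) - R * dX f c
      = -(Complex.I * (R * Real.sin θ : ℝ)
          * cauchyRiemann f (c + t * (R * Complex.exp (θ * Complex.I)))
          * Complex.exp (-θ * Complex.I))
        + R * (dX f (c + (t * R : ℝ) * Complex.exp (θ * Complex.I)) - dX f c) := by
    intro θ
    have e1 : ((R : ℂ) * Complex.exp (θ * Complex.I)).im = R * Real.sin θ := by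
      rw [Complex.im_ofReal_mul, Complex.exp_ofReal_mul_I_im]
    have e3 : Complex.exp (θ * Complex.I) * Complex.exp (-θ * Complex.I) = 1 := by
      rw [← Complex.exp_add]; simp
    have e4 : c + ((t * R : ℝ) : ℂ) * Complex.exp (θ * Complex.I)
        = c + t * (R * Complex.exp (θ * Complex.I)) := by push_cast; ring
    rw [fderiv_apply_eq, e1, e4]
    linear_combination (R * dX f (c + t * (R * Complex.exp (θ * Complex.I)))) * e3
  simp only [hpt]
  rw [integral_add, intervalIntegral.integral_const_mul]
  · refine (norm_add_le _ _).trans (add_le_add ?_ ?_)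
    · refine (norm_integral_le_of_norm_le_const (C := R * δ) fun θ _ => ?_).trans ?_
      · rw [norm_neg, norm_mul, norm_mul, norm_mul, ← Complex.ofReal_neg,
          Complex.norm_exp_ofReal_mul_I, Complex.norm_I, Complex.norm_real, mul_one, one_mul,
          norm_mul, Real.norm_of_nonneg hR]
        exact mul_le_mul (mul_le_of_le_one_right hR (Real.abs_sin_le_one θ))
          (hδ _ (norm_circle_le ⟨ht.1.le, ht.2⟩ hR θ)) (norm_nonneg _) hR
      · rw [sub_zero, abs_of_pos Real.two_pi_pos]
    · rw [norm_mul, Complex.norm_real, Real.norm_of_nonneg hR]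
      refine mul_le_mul_of_nonneg_left ?_ hR
      refine (norm_integral_circle_sub_le (contDiff_dX hf) htR
        (fun z hz => hδ' z (hz.trans htR'))).trans ?_
      gcongr
  · exact Continuous.intervalIntegrable (by fun_prop) _ _
  · exact Continuous.intervalIntegrable (by fun_prop) _ _

/-! ### Taylor's formula with Cauchy–Riemann defect -/

/-- The growth of an almost holomorphic function is controlled by its derivative. -/
theorem norm_sub_le_of_dX {F : ℂ → ℂ} (hF : ContDiff ℝ ∞ F) {c : ℂ} {ρ B δ : ℝ}
    (hB : ∀ z, ‖z - c‖ ≤ ρ → ‖dX F z‖ ≤ B)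
    (hδ : ∀ z, ‖z - c‖ ≤ ρ → ‖cauchyRiemann F z‖ ≤ δ) {z : ℂ} (hz : ‖z - c‖ ≤ ρ) :
    ‖F z - F c‖ ≤ (B + δ) * ρ := by
  have hρ : 0 ≤ ρ := (norm_nonneg _).trans hz
  have hB0 : 0 ≤ B := (norm_nonneg _).trans (hB z hz)
  have hδ0 : 0 ≤ δ := (norm_nonneg _).trans (hδ z hz)
  refine ((convex_closedBall c ρ).norm_image_sub_le_of_norm_fderiv_le (𝕜 := ℝ) (C := B + δ)
    (fun t _ => differentiable_of_smooth hF t) (fun t ht => ?_)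
    (Metric.mem_closedBall_self hρ) (by simpa [dist_eq_norm] using hz)).trans (by gcongr)
  have ht' : ‖t - c‖ ≤ ρ := by simpa [dist_eq_norm] using ht
  refine ContinuousLinearMap.opNorm_le_bound _ (by positivity) fun v => ?_
  rw [fderiv_apply_eq]
  refine (norm_sub_le _ _).trans ?_
  rw [norm_mul, norm_mul, norm_mul, Complex.norm_I, one_mul, Complex.norm_real]
  have h1 := hB t ht'
  have h2 := hδ t ht'
  have h3 : ‖v.im‖ ≤ ‖v‖ := Complex.abs_im_le_norm v
  calc ‖v‖ * ‖dX F t‖ + ‖v.im‖ * ‖cauchyRiemann F t‖ ≤ ‖v‖ * B + ‖v‖ * δ := by gcongr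
    _ = (B + δ) * ‖v‖ := by ring

/-- The Taylor polynomial of degree `< k` of an almost holomorphic function. -/
noncomputable def taylorPoly (k : ℕ) (f : ℂ → ℂ) (c z : ℂ) : ℂ :=
  ∑ j ∈ Finset.range k, (z - c) ^ j / (j.factorial : ℂ) * dX^[j] f c

theorem hasDerivAt_taylorPoly (k : ℕ) (f : ℂ → ℂ) (c z : ℂ) :
    HasDerivAt (taylorPoly (k + 1) f c) (taylorPoly k (dX f) c z) z := by
  have h : ∀ j ∈ Finset.range (k + 1), HasDerivAt
      (fun z => (z - c) ^ j / (j.factorial : ℂ) * dX^[j] f c)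
      ((j * (z - c) ^ (j - 1)) / (j.factorial : ℂ) * dX^[j] f c) z := by
    intro j _
    have := ((((hasDerivAt_id z).sub_const c).pow j).div_const (j.factorial : ℂ)).mul_const
      (dX^[j] f c)
    simpa using this
  have hs := HasDerivAt.fun_sum h
  refine hs.congr_deriv ?_
  rw [Finset.sum_range_succ', taylorPoly]
  simp only [Nat.cast_zero, zero_mul, zero_div, add_zero]
  refine Finset.sum_congr rfl fun j _ => ?_
  rw [Nat.factorial_succ, Function.iterate_succ_apply, Nat.add_sub_cancel]
  have h1 : ((j + 1 : ℕ) : ℂ) ≠ 0 := by exact_mod_cast Nat.succ_ne_zero j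
  have h2 : (j.factorial : ℂ) ≠ 0 := by exact_mod_cast Nat.factorial_ne_zero j
  push_cast at h1 ⊢
  field_simp

theorem taylorPoly_succ_center (k : ℕ) (f : ℂ → ℂ) (c : ℂ) : taylorPoly (k + 1) f c c = f c := by
  rw [taylorPoly, Finset.sum_range_succ']
  simp

theorem contDiff_taylorPoly (k : ℕ) (f : ℂ → ℂ) (c : ℂ) :
    ContDiff ℝ ∞ (taylorPoly k f c) := by
  unfold taylorPoly
  fun_prop

theorem fderiv_taylorPoly (k : ℕ) (f : ℂ → ℂ) (c z v : ℂ) :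
    fderiv ℝ (taylorPoly (k + 1) f c) z v = v * taylorPoly k (dX f) c z := by
  have h := ((hasDerivAt_taylorPoly k f c z).hasFDerivAt.restrictScalars ℝ).fderiv
  rw [h]
  simp

/-- Taylor's formula for almost holomorphic functions, on discs of radius at most one. -/
theorem norm_sub_taylorPoly_le (k : ℕ) {f : ℂ → ℂ} (hf : ContDiff ℝ ∞ f) {c : ℂ} {ρ B δ : ℝ}
    (hρ : ρ ≤ 1) (hB : ∀ z, ‖z - c‖ ≤ ρ → ‖dX^[k] f z‖ ≤ B)
    (hδ : ∀ j < k, ∀ z, ‖z - c‖ ≤ ρ → ‖cauchyRiemann (dX^[j] f) z‖ ≤ δ) {z : ℂ}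
    (hz : ‖z - c‖ ≤ ρ) :
    ‖f z - taylorPoly k f c z‖ ≤ B * ρ ^ k + k * δ := by
  induction k generalizing f z with
  | zero => simpa [taylorPoly] using hB z hz
  | succ k ih =>
    have hρ0 : 0 ≤ ρ := (norm_nonneg _).trans hz
    have hδ0 : 0 ≤ δ := (norm_nonneg _).trans (hδ 0 k.succ_pos z hz)
    have hB0 : 0 ≤ B := (norm_nonneg _).trans (hB z hz)
    have hT := contDiff_taylorPoly (k + 1) f c
    have hd : ∀ z v, fderiv ℝ (fun z => f z - taylorPoly (k + 1) f c z) z v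
        = fderiv ℝ f z v - v * taylorPoly k (dX f) c z := by
      intro z v
      rw [fderiv_fun_sub (differentiable_of_smooth hf z) (differentiable_of_smooth hT z),
        sub_apply, fderiv_taylorPoly]
    -- Differentiating the remainder of `f` gives the remainder of `dX f` with one term fewer, which
    -- is the induction hypothesis. The polynomial is holomorphic, so the Cauchy–Riemann defect
    -- stays that of `f`.
    have hdx : ∀ z, dX (fun z => f z - taylorPoly (k + 1) f c z) z
        = dX f z - taylorPoly k (dX f) c z := by
      intro z; rw [dX, hd, one_mul]; rfl
    have hcr : ∀ z, cauchyRiemann (fun z => f z - taylorPoly (k + 1) f c z) z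
        = cauchyRiemann f z := by
      intro z
      rw [cauchyRiemann, hdx, dY, hd, cauchyRiemann, dY]
      linear_combination (-taylorPoly k (dX f) c z) * Complex.I_sq
    have h := norm_sub_le_of_dX (hf.sub hT) (c := c) (ρ := ρ) (B := B * ρ ^ k + k * δ) (δ := δ)
      (fun z hz => by
        rw [hdx]
        exact ih (contDiff_dX hf) hB (fun j hj z hz => hδ (j + 1) (by omega) z hz) hz)
      (fun z hz => by rw [hcr]; exact hδ 0 k.succ_pos z hz) hz
    simp only [taylorPoly_succ_center, sub_self, sub_zero] at h
    refine h.trans ?_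
    calc (B * ρ ^ k + k * δ + δ) * ρ = B * ρ ^ (k + 1) + (k * δ + δ) * ρ := by ring
      -- Here `ρ ≤ 1` keeps the accumulated defect linear in `k`.
      _ ≤ B * ρ ^ (k + 1) + (k * δ + δ) * 1 := by gcongr
      _ = B * ρ ^ (k + 1) + (k + 1 : ℕ) * δ := by push_cast; ring

/-! ### Membership in sharp balls -/

theorem tendsto_eps : Tendsto (fun ε : Eps => (ε : ℝ)) atBot (nhds 0) := by
  rw [tendsto_order]
  refine ⟨fun a ha => Eventually.of_forall fun ε => ha.trans ε.pos, fun a ha => ?_⟩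
  have h1 : (0 : ℝ) < min (a / 2) (1 / 2) := by positivity
  have h2 : min (a / 2) ((1 : ℝ) / 2) < 1 := (min_le_right _ _).trans_lt (by norm_num)
  filter_upwards [eventually_le_atBot (⟨_, h1, h2⟩ : Eps)] with ε hε
  have hε' : (ε : ℝ) ≤ min (a / 2) (1 / 2) := hε
  have := hε'.trans (min_le_left _ _)
  linarith

/-- Any constant can be absorbed by an arbitrarily small loss in the exponent, which is why the
estimates below interpolate exponents. -/
theorem eventually_mul_rpow_le (C : ℝ) {p q : ℝ} (h : p < q) :
    ∀ᶠ ε : Eps in atBot, C * (ε : ℝ) ^ q ≤ (ε : ℝ) ^ p := by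
  have ht : Tendsto (fun ε : Eps => C * (ε : ℝ) ^ (q - p)) atBot (nhds 0) := by
    have := (tendsto_eps.rpow_const (p := q - p) (Or.inr (sub_pos.2 h).le)).const_mul C
    rwa [Real.zero_rpow (sub_pos.2 h).ne', mul_zero] at this
  filter_upwards [ht.eventually_le_const one_pos] with ε hε
  have hp : 0 < (ε : ℝ) ^ p := Real.rpow_pos_of_pos ε.pos p
  calc C * (ε : ℝ) ^ q = (C * (ε : ℝ) ^ (q - p)) * (ε : ℝ) ^ p := by
        rw [mul_assoc, ← Real.rpow_add ε.pos]; congr 2; ring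
    _ ≤ 1 * (ε : ℝ) ^ p := by gcongr
    _ = (ε : ℝ) ^ p := one_mul _

theorem Eps.rpow_le_rpow (ε : Eps) {p q : ℝ} (h : p ≤ q) : (ε : ℝ) ^ q ≤ (ε : ℝ) ^ p :=
  Real.rpow_le_rpow_of_exponent_ge ε.pos ε.le_one h

theorem negligible_iff_rpow {x : Eps → ℂ} :
    Negligible x ↔ ∀ q : ℝ, ∀ᶠ ε in atBot, ‖x ε‖ ≤ (ε : ℝ) ^ q := by
  refine ⟨fun h q => ?_, fun h m => by simpa using h m⟩
  obtain ⟨m, hm⟩ := exists_nat_ge q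
  filter_upwards [h m] with ε hε
  rw [← Real.rpow_natCast] at hε
  exact hε.trans (ε.rpow_le_rpow hm)

theorem moderate_iff_rpow {x : Eps → ℂ} :
    Moderate x ↔ ∃ q : ℝ, ∀ᶠ ε in atBot, ‖x ε‖ ≤ (ε : ℝ) ^ q := by
  constructor
  · rintro ⟨N, hN⟩
    refine ⟨-N, ?_⟩
    filter_upwards [hN] with ε hε
    rwa [Real.rpow_neg ε.pos.le, Real.rpow_natCast]
  · rintro ⟨q, hq⟩
    obtain ⟨N, hN⟩ := exists_nat_ge (-q)
    refine ⟨N, ?_⟩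
    filter_upwards [hq] with ε hε
    rw [← Real.rpow_natCast, ← Real.rpow_neg ε.pos.le]
    exact hε.trans (ε.rpow_le_rpow (by linarith))

theorem sharpNorm_lt_iff (z : GenComplex) {r : ℝ} (hr : 0 < r) :
    sharpNorm z < r ↔ ((-Real.log r : ℝ) : EReal) < valuation z := by
  rw [sharpNorm]
  induction h : valuation z with
  -- This case must be excluded: there the exponential is `∞`, whose `toReal` is the default value
  -- `0`.
  | bot => exact absurd h (valuation_ne_bot z)
  | top => simpa [hr] using EReal.coe_lt_top (-Real.log r)
  | coe a =>
    rw [← EReal.coe_neg, EReal.exp_coe, ENNReal.toReal_ofReal (Real.exp_pos _).le,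
      EReal.coe_lt_coe_iff, ← Real.lt_log_iff_exp_lt hr, neg_lt]

/-- The strict inequality leaves room for one exponent above `-Real.log r`, so points of the open
sharp ball are described by honest discs of radius `ε ^ b`. -/
theorem sharpNorm_mk_sub_lt_iff (x c : moderateNets) {r : ℝ} (hr : 0 < r) :
    sharpNorm (GenComplex.mk x - GenComplex.mk c) < r ↔ ∃ b : ℝ, -Real.log r < b ∧
      ∀ᶠ ε in atBot, ‖(x : Eps → ℂ) ε - (c : Eps → ℂ) ε‖ ≤ (ε : ℝ) ^ b := by
  have hv : valuation (GenComplex.mk x - GenComplex.mk c)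
      = netValuation (fun ε => (x : Eps → ℂ) ε - (c : Eps → ℂ) ε) := rfl
  rw [sharpNorm_lt_iff _ hr, hv, netValuation, lt_sSup_iff]
  constructor
  · rintro ⟨_, ⟨b, hb, rfl⟩, h⟩
    exact ⟨b, EReal.coe_lt_coe_iff.1 h, hb⟩
  · rintro ⟨b, h, hb⟩
    exact ⟨b, ⟨b, hb, rfl⟩, EReal.coe_lt_coe_iff.2 h⟩

/-- An invertible generalized number is bounded below by a power of `ε`. -/
theorem exists_pow_le_of_isUnit {w : moderateNets} (hw : IsUnit (GenComplex.mk w)) :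
    ∃ N : ℕ, ∀ᶠ ε : Eps in atBot, (ε : ℝ) ^ N ≤ ‖(w : Eps → ℂ) ε‖ := by
  obtain ⟨y', hy'⟩ := hw.exists_right_inv
  obtain ⟨y, rfl⟩ := Ideal.Quotient.mk_surjective y'
  have hn : Negligible (fun ε => (w : Eps → ℂ) ε * (y : Eps → ℂ) ε - 1) :=
    Ideal.Quotient.eq.1 (hy'.trans (map_one (Ideal.Quotient.mk negligibleNets)).symm)
  obtain ⟨N, hN⟩ := y.2
  -- The inverse is at most `ε ^ (-N)` and the product has modulus at least `1 / 2`; the extra power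
  -- of `ε` absorbs this `1 / 2`.
  refine ⟨N + 1, ?_⟩
  filter_upwards [hn 1, hN, eventually_le_half] with ε h1 h2 h3
  have hp := pow_pos ε.pos N
  have h4 : 1 ≤ ‖(w : Eps → ℂ) ε‖ * ‖(y : Eps → ℂ) ε‖ + 1 / 2 := by
    rw [← norm_mul]
    have := norm_sub_norm_le (1 : ℂ) (1 - (w : Eps → ℂ) ε * (y : Eps → ℂ) ε)
    rw [sub_sub_cancel, norm_one, norm_sub_rev] at this
    rw [pow_one] at h1
    linarith
  have h5 : ‖(w : Eps → ℂ) ε‖ * ‖(y : Eps → ℂ) ε‖ ≤ ‖(w : Eps → ℂ) ε‖ * ((ε : ℝ) ^ N)⁻¹ := by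
    gcongr
  have h6 : 1 / 2 ≤ ‖(w : Eps → ℂ) ε‖ * ((ε : ℝ) ^ N)⁻¹ := by linarith
  rw [← div_eq_mul_inv, le_div_iff₀ hp] at h6
  rw [pow_succ]
  nlinarith

theorem moderate_pow (n : ℕ) : Moderate (fun ε => ((ε : ℝ) : ℂ) ^ n) := by
  refine ⟨0, Eventually.of_forall fun ε => ?_⟩
  rw [norm_pow, Complex.norm_real, Real.norm_of_nonneg ε.pos.le, pow_zero, inv_one]
  exact pow_le_one₀ ε.pos.le ε.le_one

theorem isUnit_mk_pow (n : ℕ) :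
    IsUnit (GenComplex.mk ⟨fun ε => ((ε : ℝ) : ℂ) ^ n, moderate_pow n⟩) := by
  have hinv : Moderate (fun ε => (((ε : ℝ) : ℂ) ^ n)⁻¹) := by
    refine ⟨n, Eventually.of_forall fun ε => ?_⟩
    rw [norm_inv, norm_pow, Complex.norm_real, Real.norm_of_nonneg ε.pos.le]
  refine (isUnit_iff_exists_inv.2 ⟨⟨_, hinv⟩, Subtype.ext (funext fun ε => ?_)⟩).map
    (Ideal.Quotient.mk negligibleNets)
  exact mul_inv_cancel₀ (pow_ne_zero _ (by exact_mod_cast ε.pos.ne'))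

/-- Every sharp ball contains points whose difference to the center is invertible. -/
theorem exists_isUnit_sub_mem_sharpBall (z₀ : GenComplex) {s : ℝ} (hs : 0 < s) :
    ∃ z, IsUnit (z - z₀) ∧ z ∈ sharpBall z₀ s := by
  obtain ⟨c, rfl⟩ := Ideal.Quotient.mk_surjective z₀
  obtain ⟨n, hn⟩ := exists_nat_gt (-Real.log s)
  refine ⟨GenComplex.mk (c + ⟨_, moderate_pow n⟩), ?_, ?_⟩
  · have h : GenComplex.mk (c + ⟨_, moderate_pow n⟩) - Ideal.Quotient.mk negligibleNets c
        = GenComplex.mk ⟨_, moderate_pow n⟩ := by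
      rw [← map_sub, add_sub_cancel_left]
    rw [h]
    exact isUnit_mk_pow n
  · refine (sharpNorm_mk_sub_lt_iff _ c hs).2 ⟨n, hn, Eventually.of_forall fun ε => ?_⟩
    have h : ((c + ⟨_, moderate_pow n⟩ : moderateNets) : Eps → ℂ) ε - (c : Eps → ℂ) ε
        = ((ε : ℝ) : ℂ) ^ n := add_sub_cancel_left _ _
    rw [h, norm_pow, Complex.norm_real, Real.norm_of_nonneg ε.pos.le, Real.rpow_natCast]

/-! ### Uniform bounds on discs of radius `ε ^ b` -/

/-- `|f_ε| ≤ ε ^ q` on the disc of center `c_ε` and radius `ε ^ b`, for small `ε`. -/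
def UniformBound (c : Eps → ℂ) (f : Eps → ℂ → ℂ) (b q : ℝ) : Prop :=
  ∀ᶠ ε : Eps in atBot, ∀ z, ‖z - c ε‖ ≤ (ε : ℝ) ^ b → ‖f ε z‖ ≤ (ε : ℝ) ^ q

theorem UniformBound.mono {c : Eps → ℂ} {f : Eps → ℂ → ℂ} {b b' q q' : ℝ}
    (h : UniformBound c f b q) (hb : b ≤ b') (hq : q' ≤ q) : UniformBound c f b' q' := by
  filter_upwards [h] with ε hε z hz
  exact (hε z (hz.trans (ε.rpow_le_rpow hb))).trans (ε.rpow_le_rpow hq)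

/-- By compactness each `f ε` attains its maximal modulus on the disc. The maximizers form a net
which, since `b > -log r`, represents a point of the sharp ball, so a bound along this single net is
uniform on the discs. -/
theorem exists_maximizing_net (c : moderateNets) {r b : ℝ} (hr : 0 < r) (hb : -Real.log r < b)
    {f : Eps → ℂ → ℂ} (hf : ∀ ε, Continuous (f ε)) :
    ∃ x : moderateNets, GenComplex.mk x ∈ sharpBall (GenComplex.mk c) r ∧
      ∀ ε : Eps, ∀ z, ‖z - (c : Eps → ℂ) ε‖ ≤ (ε : ℝ) ^ b → ‖f ε z‖ ≤ ‖f ε ((x : Eps → ℂ) ε)‖ := by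
  have key : ∀ ε : Eps, ∃ x, ‖x - (c : Eps → ℂ) ε‖ ≤ (ε : ℝ) ^ b ∧
      ∀ z, ‖z - (c : Eps → ℂ) ε‖ ≤ (ε : ℝ) ^ b → ‖f ε z‖ ≤ ‖f ε x‖ := by
    intro ε
    obtain ⟨x, hx, hmax⟩ := (isCompact_closedBall ((c : Eps → ℂ) ε) ((ε : ℝ) ^ b)).exists_isMaxOn
      ⟨_, Metric.mem_closedBall_self (Real.rpow_pos_of_pos ε.pos b).le⟩ (hf ε).norm.continuousOn
    exact ⟨x, by simpa [dist_eq_norm] using hx,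
      fun z hz => hmax (by simpa [dist_eq_norm] using hz)⟩
  choose x hx hmax using key
  have hxm : Moderate x := by
    have h : Moderate (fun ε => x ε - (c : Eps → ℂ) ε) :=
      moderate_iff_rpow.2 ⟨b, Eventually.of_forall hx⟩
    simpa using h.add c.2
  exact ⟨⟨x, hxm⟩, (sharpNorm_mk_sub_lt_iff ⟨x, hxm⟩ c hr).2 ⟨b, hb, Eventually.of_forall hx⟩, hmax⟩

theorem SmoothWith.exists_uniformBound {c : moderateNets} {r b : ℝ} (hr : 0 < r)
    (hb : -Real.log r < b) {f : Eps → ℂ → ℂ}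
    (hf : SmoothWith Moderate (sharpBall (GenComplex.mk c) r) f) :
    ∃ q, UniformBound c f b q := by
  obtain ⟨x, hx, hmax⟩ := exists_maximizing_net c hr hb fun ε => (hf.1 ε).continuous
  obtain ⟨q, hq⟩ := moderate_iff_rpow.1 (hf.2 0 0 x hx)
  refine ⟨q, ?_⟩
  filter_upwards [hq] with ε hε z hz
  exact (hmax ε z hz).trans hε

theorem SmoothWith.uniformBound {c : moderateNets} {r b : ℝ} (hr : 0 < r)
    (hb : -Real.log r < b) {f : Eps → ℂ → ℂ}
    (hf : SmoothWith Negligible (sharpBall (GenComplex.mk c) r) f) (q : ℝ) :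
    UniformBound c f b q := by
  obtain ⟨x, hx, hmax⟩ := exists_maximizing_net c hr hb fun ε => (hf.1 ε).continuous
  filter_upwards [negligible_iff_rpow.1 (hf.2 0 0 x hx) q] with ε hε z hz
  exact (hmax ε z hz).trans hε

/-! ### Nets that are holomorphic up to negligible nets -/

/-- Moderate nets of functions satisfying the Cauchy–Riemann equation up to negligible nets. -/
structure AlmostHolomorphic (A : Set GenComplex) (f : Eps → ℂ → ℂ) : Prop where
  moderate : SmoothWith Moderate A f
  negligible : SmoothWith Negligible A fun ε => cauchyRiemann (f ε)

theorem cauchyRiemann_dX {f : ℂ → ℂ} (hf : ContDiff ℝ ∞ f) :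
    cauchyRiemann (dX f) = dX (cauchyRiemann f) := by
  funext z
  have h1 := differentiable_of_smooth (contDiff_dX hf) z
  have h2 := differentiable_of_smooth (contDiff_dY hf) z
  change _ = fderiv ℝ (fun z => dX f z + Complex.I * dY f z) z 1
  rw [cauchyRiemann, dY_dX hf, fderiv_fun_add h1 (h2.const_mul _), fderiv_const_mul h2]
  rfl

theorem AlmostHolomorphic.dX {A : Set GenComplex} {f : Eps → ℂ → ℂ}
    (hf : AlmostHolomorphic A f) : AlmostHolomorphic A fun ε => dX (f ε) := by
  refine ⟨hf.moderate.dX, ?_⟩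
  simp only [cauchyRiemann_dX (hf.moderate.1 _)]
  exact hf.negligible.dX

theorem AlmostHolomorphic.dX_iterate {A : Set GenComplex} {f : Eps → ℂ → ℂ}
    (hf : AlmostHolomorphic A f) (k : ℕ) :
    AlmostHolomorphic A fun ε => Colombeau.dX^[k] (f ε) := by
  induction k generalizing f with
  | zero => exact hf
  | succ k ih => exact ih hf.dX

/-! ### From the derivatives at the center to the whole ball -/

section

variable {c : moderateNets} {r b : ℝ} {f : Eps → ℂ → ℂ}

/-- The Cauchy estimate for nets. -/
theorem AlmostHolomorphic.uniformBound_dX (hr : 0 < r) (hb : -Real.log r < b)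
    (hf : AlmostHolomorphic (sharpBall (GenComplex.mk c) r) f) {b' q : ℝ} (hbb : b < b')
    (h : UniformBound c f b q) : UniformBound c (fun ε => Colombeau.dX (f ε)) b' (q - b') := by
  -- Cauchy's estimate is used on radius `ε ^ m` about `z`. As `b < m < b'`, this disc stays within
  -- radius `2 * ε ^ m ≤ ε ^ b` of the center, and `m < b'` absorbs the factor `3`. The defect
  -- exponent `max (q - m) (q - 2 * m)` makes both error terms at most `ε ^ q`.
  obtain ⟨m, hm1, hm2⟩ := exists_between hbb
  filter_upwards [h, hf.negligible.uniformBound hr hb (max (q - m) (q - 2 * m)),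
    hf.dX.negligible.uniformBound hr hb (max (q - m) (q - 2 * m)),
    eventually_mul_rpow_le 2 hm1, eventually_mul_rpow_le 3 (show q - b' < q - m by linarith)]
    with ε h1 h2 h3 h4 h5 z hz
  have hR : 0 < (ε : ℝ) ^ m := Real.rpow_pos_of_pos ε.pos m
  have hball : ∀ w, ‖w - z‖ ≤ (ε : ℝ) ^ m → ‖w - (c : Eps → ℂ) ε‖ ≤ (ε : ℝ) ^ b := by
    intro w hw
    have := norm_sub_le_norm_sub_add_norm_sub w z ((c : Eps → ℂ) ε)
    have := ε.rpow_le_rpow hm2.le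
    linarith
  have hC := cauchy_estimate (hf.moderate.1 ε) (c := z) hR.le
    (fun w hw => h1 w (hball w hw)) (fun w hw => h2 w (hball w hw))
    (fun w hw => h3 w (hball w hw))
  have i1 := ε.rpow_le_rpow (le_max_left (q - m) (q - 2 * m))
  have i2 := ε.rpow_le_rpow (le_max_right (q - m) (q - 2 * m))
  have i3 : (ε : ℝ) ^ m * (ε : ℝ) ^ (q - m) = (ε : ℝ) ^ q := by
    rw [← Real.rpow_add ε.pos]; congr 1; ring
  have i4 : ((ε : ℝ) ^ m) ^ 2 * (ε : ℝ) ^ (q - 2 * m) = (ε : ℝ) ^ q := by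
    rw [← Real.rpow_natCast, ← Real.rpow_mul ε.pos.le, ← Real.rpow_add ε.pos]
    congr 1; push_cast; ring
  refine le_trans (le_of_mul_le_mul_left ?_ hR) h5
  calc (ε : ℝ) ^ m * ‖Colombeau.dX (f ε) z‖ ≤ _ := hC
    _ ≤ (ε : ℝ) ^ q + (ε : ℝ) ^ m * (ε : ℝ) ^ (q - m)
        + ((ε : ℝ) ^ m) ^ 2 * (ε : ℝ) ^ (q - 2 * m) := by gcongr
    _ = (ε : ℝ) ^ m * (3 * (ε : ℝ) ^ (q - m)) := by rw [i3, i4, mul_left_comm, i3]; ring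

/-- Each derivative costs only `b'`, which may be as close to `b` as desired. Every step shrinks the
disc a little, hence the induction over all `b' > b`. -/
theorem AlmostHolomorphic.uniformBound_dX_iterate (hr : 0 < r) (hb : -Real.log r < b)
    (hf : AlmostHolomorphic (sharpBall (GenComplex.mk c) r) f) {q : ℝ}
    (h : UniformBound c f b q) (k : ℕ) {b' : ℝ} (hbb : b < b') :
    UniformBound c (fun ε => Colombeau.dX^[k] (f ε)) b' (q - k * b') := by
  induction k generalizing b' with
  | zero => exact h.mono hbb.le (by simp)
  | succ k ih =>
    obtain ⟨m, hm1, hm2⟩ := exists_between hbb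
    have h' := (hf.dX_iterate k).uniformBound_dX hr (hb.trans hm1) hm2 (ih hm1)
    simp only [← Function.iterate_succ_apply' Colombeau.dX] at h'
    refine h'.mono le_rfl ?_
    have : (k : ℝ) * m ≤ k * b' := by gcongr
    push_cast
    linarith

/-- A net with negligible value at the center is bounded in terms of its derivative. -/
theorem AlmostHolomorphic.uniformBound_of_dX (hr : 0 < r) (hb : -Real.log r < b)
    (hf : AlmostHolomorphic (sharpBall (GenComplex.mk c) r) f)
    (h0 : Negligible fun ε => f ε ((c : Eps → ℂ) ε)) {b₀ p : ℝ} (hbb : b₀ < b)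
    (h : UniformBound c (fun ε => Colombeau.dX (f ε)) b p) : UniformBound c f b (p + b₀) := by
  filter_upwards [h, hf.negligible.uniformBound hr hb p, negligible_iff_rpow.1 h0 (p + b),
    eventually_mul_rpow_le 3 (show p + b₀ < p + b by linarith)] with ε h1 h2 h3 h4 z hz
  have h5 := norm_sub_le_of_dX (hf.moderate.1 ε) h1 h2 hz
  have h6 := norm_sub_norm_le (f ε z) (f ε ((c : Eps → ℂ) ε))
  have h7 : (ε : ℝ) ^ (p + b) = (ε : ℝ) ^ p * (ε : ℝ) ^ b := Real.rpow_add ε.pos _ _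
  rw [h7] at h3 h4
  linarith

/-- If all derivatives at the center are negligible, so is the net on the whole ball. -/
theorem AlmostHolomorphic.uniformBound_of_center (hr : 0 < r) (hb : -Real.log r < b)
    (hf : AlmostHolomorphic (sharpBall (GenComplex.mk c) r) f)
    (h0 : ∀ k : ℕ, Negligible fun ε => Colombeau.dX^[k] (f ε) ((c : Eps → ℂ) ε)) (q : ℝ) :
    UniformBound c f b q := by
  obtain ⟨b₁, hb₁, hb₁b⟩ := exists_between hb
  obtain ⟨b₂, hb₂, hb₂b⟩ := exists_between hb₁b
  obtain ⟨b₃, hb₃, hb₃b⟩ := exists_between hb₂b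
  obtain ⟨p, hp⟩ := hf.moderate.exists_uniformBound hr hb₁
  -- This `n` gives `p + n * (b₃ - b₂) ≥ q`.
  obtain ⟨n, hn⟩ := exists_nat_ge ((q - p) / (b₃ - b₂))
  -- Integrating `k` times from the center, each time with gain `b₃ < b`.
  have step : ∀ (k : ℕ) (g : Eps → ℂ → ℂ),
      AlmostHolomorphic (sharpBall (GenComplex.mk c) r) g →
      (∀ k : ℕ, Negligible fun ε => Colombeau.dX^[k] (g ε) ((c : Eps → ℂ) ε)) → ∀ s : ℝ,
      UniformBound c (fun ε => Colombeau.dX^[k] (g ε)) b s → UniformBound c g b (s + k * b₃) := by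
    intro k
    induction k with
    | zero => intro g _ _ s h; simpa using h
    | succ k ih =>
      intro g hg hg0 s h
      refine (hg.uniformBound_of_dX hr hb (hg0 0) hb₃b
        (ih _ hg.dX (fun j => hg0 (j + 1)) s h)).mono le_rfl ?_
      push_cast
      linarith
  refine (step n f hf h0 _ ((hf.uniformBound_dX_iterate hr hb₁ hp n hb₂).mono
    (hb₃.trans hb₃b).le le_rfl)).mono le_rfl ?_
  rw [div_le_iff₀ (sub_pos.2 hb₃)] at hn
  linarith

theorem AlmostHolomorphic.negligible_of_center (hr : 0 < r)
    (hf : AlmostHolomorphic (sharpBall (GenComplex.mk c) r) f)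
    (h0 : ∀ k : ℕ, Negligible fun ε => Colombeau.dX^[k] (f ε) ((c : Eps → ℂ) ε))
    {x : moderateNets} (hx : GenComplex.mk x ∈ sharpBall (GenComplex.mk c) r) :
    Negligible fun ε => f ε ((x : Eps → ℂ) ε) := by
  obtain ⟨b, hb, hxb⟩ := (sharpNorm_mk_sub_lt_iff x c hr).1 hx
  refine negligible_iff_rpow.2 fun q => ?_
  filter_upwards [hxb, hf.uniformBound_of_center hr hb h0 q] with ε h1 h2
  exact h2 _ h1

end

/-! ### From accumulating zeroes to the derivatives at the center -/

section

variable {c : moderateNets} {r : ℝ} {f : Eps → ℂ → ℂ}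

/-- If the center is a strict accumulation point of zeroes, all derivatives at the center are
negligible. -/
theorem AlmostHolomorphic.negligible_dX_iterate_center (hr : 0 < r)
    (hf : AlmostHolomorphic (sharpBall (GenComplex.mk c) r) f)
    (hacc : ∀ s : ℝ, 0 < s → ∃ x : moderateNets, IsUnit (GenComplex.mk x - GenComplex.mk c) ∧
      sharpNorm (GenComplex.mk x - GenComplex.mk c) < s ∧
      Negligible fun ε => f ε ((x : Eps → ℂ) ε)) (k : ℕ) :
    Negligible fun ε => Colombeau.dX^[k] (f ε) ((c : Eps → ℂ) ε) := by
  induction k using Nat.strong_induction_on with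
  | _ k ih =>
  refine negligible_iff_rpow.2 fun q => ?_
  -- The disc of radius `ε ^ b₀` belongs to the sharp ball and has radius at most one, as Taylor's
  -- formula requires even when `r > 1`.
  set b₀ := max (-Real.log r) 0 + 1 with hb₀
  have hb₀r : -Real.log r < b₀ := (le_max_left _ _).trans_lt (lt_add_one _)
  have hb₀0 : 0 < b₀ := (le_max_right _ _).trans_lt (lt_add_one _)
  obtain ⟨p, hp⟩ := (hf.dX_iterate (k + 1)).moderate.exists_uniformBound hr hb₀r
  -- A zero within `ε ^ b₁` of the center makes the remainder, once divided by `|x - c| ^ k`, at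
  -- most `ε ^ (p + b₁) ≤ ε ^ (q + 1)`.
  set b₁ := max b₀ (q + 1 - p) with hb₁
  obtain ⟨x, hunit, hnorm, hx0⟩ := hacc (Real.exp (-b₁)) (Real.exp_pos _)
  obtain ⟨b, hb, hxc⟩ := (sharpNorm_mk_sub_lt_iff x c (Real.exp_pos _)).1 hnorm
  rw [Real.log_exp, neg_neg] at hb
  rw [← map_sub] at hunit
  obtain ⟨N, hN⟩ := exists_pow_le_of_isUnit hunit
  -- Chosen after the zero, since `N` depends on it: `ε ^ Q ≤ ε ^ (q + 1) * |x - c| ^ k`. Negligible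
  -- quantities are below `ε ^ Q` for any such `Q`.
  set Q : ℝ := q + 1 + (N * k : ℕ) with hQ
  have hlow : ∀ᶠ ε : Eps in atBot, ∀ j ∈ Finset.range k,
      ‖Colombeau.dX^[j] (f ε) ((c : Eps → ℂ) ε)‖ ≤ (ε : ℝ) ^ Q :=
    (Filter.eventually_all_finset _).2 fun j hj =>
      negligible_iff_rpow.1 (ih j (Finset.mem_range.1 hj)) Q
  have hcr : ∀ᶠ ε : Eps in atBot, ∀ j ∈ Finset.range (k + 1), ∀ z,
      ‖z - (c : Eps → ℂ) ε‖ ≤ (ε : ℝ) ^ b₀ →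
        ‖cauchyRiemann (Colombeau.dX^[j] (f ε)) z‖ ≤ (ε : ℝ) ^ Q :=
    (Filter.eventually_all_finset _).2 fun j _ =>
      (hf.dX_iterate j).negligible.uniformBound hr hb₀r Q
  filter_upwards [hp, hxc, hN, hlow, hcr, negligible_iff_rpow.1 hx0 Q,
    eventually_mul_rpow_le (k.factorial * (2 * k + 3)) (lt_add_one q)]
    with ε h1 h2 h3 h4 h5 h6 h7
  have hw : ((x - c : moderateNets) : Eps → ℂ) ε = (x : Eps → ℂ) ε - (c : Eps → ℂ) ε := rfl
  rw [hw] at h3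
  set X := (x : Eps → ℂ) ε
  set C := (c : Eps → ℂ) ε
  have hρb₁ : ‖X - C‖ ≤ (ε : ℝ) ^ b₁ := h2.trans (ε.rpow_le_rpow hb.le)
  have hρb₀ : ‖X - C‖ ≤ (ε : ℝ) ^ b₀ := hρb₁.trans (ε.rpow_le_rpow (le_max_left _ _))
  have hρ1 : ‖X - C‖ ≤ 1 := hρb₀.trans (Real.rpow_le_one ε.pos.le ε.le_one hb₀0.le)
  have hρ0 : 0 < ‖X - C‖ := (pow_pos ε.pos N).trans_le h3
  have hT := norm_sub_taylorPoly_le (k + 1) (hf.moderate.1 ε) hρ1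
    (fun z hz => h1 z (hz.trans hρb₀))
    (fun j hj z hz => h5 j (Finset.mem_range.2 hj) z (hz.trans hρb₀)) le_rfl
  have hlowsum : ‖taylorPoly k (f ε) C X‖ ≤ k * (ε : ℝ) ^ Q := by
    refine (norm_sum_le_of_le _ (f := fun j : ℕ => (X - C) ^ j / (j.factorial : ℂ)
      * Colombeau.dX^[j] (f ε) C) (n := fun _ => (ε : ℝ) ^ Q) fun j hj => ?_).trans (by simp)
    rw [norm_mul, norm_div, norm_pow, Complex.norm_natCast]
    have hfac : (1 : ℝ) ≤ j.factorial := by exact_mod_cast Nat.one_le_iff_ne_zero.2 j.factorial_ne_zero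
    calc ‖X - C‖ ^ j / j.factorial * ‖Colombeau.dX^[j] (f ε) C‖
        ≤ 1 * (ε : ℝ) ^ Q := by
          gcongr
          · exact div_le_one_of_le₀ ((pow_le_one₀ hρ0.le hρ1).trans hfac) (by positivity)
          · exact h4 j hj
      _ = (ε : ℝ) ^ Q := one_mul _
  have hsucc : taylorPoly (k + 1) (f ε) C X = taylorPoly k (f ε) C X
      + (X - C) ^ k / (k.factorial : ℂ) * Colombeau.dX^[k] (f ε) C := Finset.sum_range_succ _ _
  -- Of the `2 * k + 2` errors, one is the value at the zero, `k` are the lower Taylor terms and `k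
  -- + 1` the Cauchy–Riemann defects.
  have hlead : ‖X - C‖ ^ k / k.factorial * ‖Colombeau.dX^[k] (f ε) C‖
      ≤ (2 * k + 2) * (ε : ℝ) ^ Q + (ε : ℝ) ^ p * ‖X - C‖ ^ (k + 1) := by
    have e : (X - C) ^ k / (k.factorial : ℂ) * Colombeau.dX^[k] (f ε) C
        = f ε X - taylorPoly k (f ε) C X - (f ε X - taylorPoly (k + 1) (f ε) C X) := by
      rw [hsucc]; ring
    have h := (norm_sub_le (f ε X - taylorPoly k (f ε) C X)
      (f ε X - taylorPoly (k + 1) (f ε) C X)).trans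
        (add_le_add ((norm_sub_le _ _).trans (add_le_add h6 hlowsum)) hT)
    rw [← e, norm_mul, norm_div, norm_pow, Complex.norm_natCast] at h
    push_cast at h
    linarith
  have hQle : (ε : ℝ) ^ Q ≤ (ε : ℝ) ^ (q + 1) * ‖X - C‖ ^ k := by
    rw [hQ, Real.rpow_add ε.pos, Real.rpow_natCast, pow_mul]
    have := Real.rpow_nonneg ε.pos.le (q + 1)
    have := (pow_pos ε.pos N).le
    gcongr
  have hple : (ε : ℝ) ^ p * ‖X - C‖ ≤ (ε : ℝ) ^ (q + 1) := by
    have := Real.rpow_nonneg ε.pos.le p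
    calc (ε : ℝ) ^ p * ‖X - C‖ ≤ (ε : ℝ) ^ p * (ε : ℝ) ^ b₁ := by gcongr
      _ = (ε : ℝ) ^ (p + b₁) := (Real.rpow_add ε.pos _ _).symm
      _ ≤ (ε : ℝ) ^ (q + 1) := ε.rpow_le_rpow (by linarith [le_max_right b₀ (q + 1 - p)])
  have hρk : 0 < ‖X - C‖ ^ k := pow_pos hρ0 k
  have hfac : (0 : ℝ) < k.factorial := by exact_mod_cast k.factorial_pos
  refine le_trans (le_of_mul_le_mul_left ?_ (div_pos hρk hfac)) h7
  calc ‖X - C‖ ^ k / k.factorial * ‖Colombeau.dX^[k] (f ε) C‖ ≤ _ := hlead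
    _ ≤ (2 * k + 2) * ((ε : ℝ) ^ (q + 1) * ‖X - C‖ ^ k)
        + (ε : ℝ) ^ (q + 1) * ‖X - C‖ ^ k := by
      rw [pow_succ' ‖X - C‖, ← mul_assoc]
      gcongr
    _ = ‖X - C‖ ^ k / k.factorial * (k.factorial * (2 * k + 3) * (ε : ℝ) ^ (q + 1)) := by
      field_simp
      ring

/-! ### Negligibility of all partial derivatives -/

theorem pDeriv_const_mul (a b : ℕ) (w : ℂ) {f : ℂ → ℂ} (hf : ContDiff ℝ ∞ f) :
    pDeriv a b (fun z => w * f z) = fun z => w * pDeriv a b f z := by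
  have hX : ∀ {g : ℂ → ℂ}, ContDiff ℝ ∞ g → dX (fun z => w * g z) = fun z => w * dX g z :=
    fun hg => funext fun z => by
      rw [dX, fderiv_const_mul (differentiable_of_smooth hg z)]; rfl
  have hY : ∀ {g : ℂ → ℂ}, ContDiff ℝ ∞ g → dY (fun z => w * g z) = fun z => w * dY g z :=
    fun hg => funext fun z => by
      rw [dY, fderiv_const_mul (differentiable_of_smooth hg z)]; rfl
  induction b generalizing f with
  | zero =>
    induction a generalizing f with
    | zero => rfl
    | succ a ih =>
      rw [← pDeriv_dX a 0 hf, ← pDeriv_dX a 0 (contDiff_const.mul hf), hX hf, ih (contDiff_dX hf)]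
  | succ b ih => rw [← pDeriv_dY, ← pDeriv_dY, hY hf, ih (contDiff_dY hf)]

/-- If all derivatives at the center are negligible, the net is negligible on the ball. -/
theorem AlmostHolomorphic.smoothWith_negligible (hr : 0 < r)
    (hf : AlmostHolomorphic (sharpBall (GenComplex.mk c) r) f)
    (h0 : ∀ k : ℕ, Negligible fun ε => Colombeau.dX^[k] (f ε) ((c : Eps → ℂ) ε)) :
    SmoothWith Negligible (sharpBall (GenComplex.mk c) r) f := by
  refine ⟨hf.moderate.1, fun a b x hx => ?_⟩
  induction b generalizing f with
  | zero =>
    refine (hf.dX_iterate a).negligible_of_center hr (fun k => ?_) hx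
    simpa only [Function.iterate_add_apply] using h0 (k + a)
  | succ b ih =>
    have hdx := ih hf.dX fun k => h0 (k + 1)
    have hcr := hf.negligible.2 a b x hx
    have hsum := ((moderate_const (-Complex.I)).mul_negligible hcr).add
      ((moderate_const Complex.I).mul_negligible hdx)
    have e : ∀ ε, pDeriv a (b + 1) (f ε) = fun z => -Complex.I * pDeriv a b (cauchyRiemann (f ε)) z
        + Complex.I * pDeriv a b (Colombeau.dX (f ε)) z := by
      intro ε
      -- A `y`-derivative is traded for an `x`-derivative and a negligible term, reducing the number
      -- of `y`-derivatives by one.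
      have hdY : Colombeau.dY (f ε) = (fun z => -Complex.I * cauchyRiemann (f ε) z)
          + fun z => Complex.I * Colombeau.dX (f ε) z := by
        funext z
        change _ = -Complex.I * cauchyRiemann (f ε) z + Complex.I * Colombeau.dX (f ε) z
        rw [cauchyRiemann]
        linear_combination Colombeau.dY (f ε) z * Complex.I_sq
      have hs1 := hf.negligible.1 ε
      have hs2 := contDiff_dX (hf.moderate.1 ε)
      rw [← pDeriv_dY, hdY, pDeriv_add a b (contDiff_const.mul hs1) (contDiff_const.mul hs2),
        pDeriv_const_mul a b _ hs1, pDeriv_const_mul a b _ hs2]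
      rfl
    simpa only [e] using hsum

end

/-! ### Translation to generalized functions -/

theorem pointValue_mk_eq_zero_iff {A : Set GenComplex} (u : moderateFunctions A) (x : moderateNets)
    (hx : GenComplex.mk x ∈ A) :
    pointValue ⟨GenComplex.mk x, hx⟩ (Ideal.Quotient.mk (negligibleFunctions A) u) = 0 ↔
      Negligible fun ε => (u : Eps → ℂ → ℂ) ε ((x : Eps → ℂ) ε) := by
  rw [pointValue_mk]
  exact Ideal.Quotient.eq_zero_iff_mem

theorem exists_iterDeriv_mk {A : Set GenComplex} (k : ℕ) (u : moderateFunctions A) :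
    ∃ v : moderateFunctions A, (v : Eps → ℂ → ℂ) = (fun ε => dX^[k] ((u : Eps → ℂ → ℂ) ε)) ∧
      iterDeriv k (Ideal.Quotient.mk (negligibleFunctions A) u)
        = Ideal.Quotient.mk (negligibleFunctions A) v := by
  induction k generalizing u with
  | zero => exact ⟨u, rfl, rfl⟩
  | succ k ih => exact ih (moderateDX A u)

theorem pointValue_iterDeriv_eq_zero_iff {A : Set GenComplex} (k : ℕ) (u : moderateFunctions A)
    (x : moderateNets) (hx : GenComplex.mk x ∈ A) :
    pointValue ⟨GenComplex.mk x, hx⟩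
        (iterDeriv k (Ideal.Quotient.mk (negligibleFunctions A) u)) = 0 ↔
      Negligible fun ε => dX^[k] ((u : Eps → ℂ → ℂ) ε) ((x : Eps → ℂ) ε) := by
  obtain ⟨v, hv, h⟩ := exists_iterDeriv_mk k u
  rw [h, pointValue_mk_eq_zero_iff, hv]

theorem partialX_mk {A : Set GenComplex} (u : moderateFunctions A) :
    partialX A (Ideal.Quotient.mk (negligibleFunctions A) u)
      = Ideal.Quotient.mk (negligibleFunctions A) (moderateDX A u) :=
  rfl

theorem partialY_mk {A : Set GenComplex} (u : moderateFunctions A) :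
    partialY A (Ideal.Quotient.mk (negligibleFunctions A) u)
      = Ideal.Quotient.mk (negligibleFunctions A) (moderateDY A u) :=
  rfl

theorem almostHolomorphic_of_mk_mem {A : Set GenComplex} {u : moderateFunctions A}
    (hu : Ideal.Quotient.mk (negligibleFunctions A) u ∈ genHolomorphic A) :
    AlmostHolomorphic A (u : Eps → ℂ → ℂ) := by
  refine ⟨u.2, ?_⟩
  have h : SmoothWith Negligible A ((moderateDX A u - -Complex.I • moderateDY A u :
      moderateFunctions A) : Eps → ℂ → ℂ) := by
    have hmk := partialX_eq hu
    rw [partialX_mk, partialY_mk, ← Ideal.Quotient.mkₐ_eq_mk ℂ, ← map_smul] at hmk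
    exact Ideal.Quotient.eq.1 hmk
  have e : ((moderateDX A u - -Complex.I • moderateDY A u : moderateFunctions A) : Eps → ℂ → ℂ)
      = fun ε => cauchyRiemann ((u : Eps → ℂ → ℂ) ε) := by
    funext ε z
    change dX ((u : Eps → ℂ → ℂ) ε) z - -Complex.I * dY ((u : Eps → ℂ → ℂ) ε) z = _
    rw [cauchyRiemann]
    ring
  rwa [e] at h

end Colombeau

/-! ### The equivalence -/

theorem mainTheorem2 (z₀ : Colombeau.GenComplex) (r : ℝ) (hr : 0 < r)
    (u : Colombeau.GenFun (Colombeau.sharpBall z₀ r))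
    (hu : u ∈ Colombeau.genHolomorphic (Colombeau.sharpBall z₀ r)) :
    List.TFAE [
      Colombeau.IsStrictAccumulationPoint z₀ (Colombeau.zeroes u),
      ∀ k : ℕ, Colombeau.pointValue ⟨z₀, Colombeau.center_mem_sharpBall z₀ hr⟩
        (Colombeau.iterDeriv k u) = 0,
      u = 0] := by
  obtain ⟨c, rfl⟩ := Ideal.Quotient.mk_surjective z₀
  obtain ⟨U, rfl⟩ := Ideal.Quotient.mk_surjective u
  have hU := Colombeau.almostHolomorphic_of_mk_mem hu
  have hcenter : ∀ k, _ ↔ _ := fun k => Colombeau.pointValue_iterDeriv_eq_zero_iff k U c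
    (Colombeau.center_mem_sharpBall _ hr)
  tfae_have 1 → 2 := by
    intro h k
    refine (hcenter k).2 (hU.negligible_dX_iterate_center hr (fun s hs => ?_) k)
    obtain ⟨z, ⟨hz, hz0⟩, hunit, hlt⟩ := h s hs
    obtain ⟨x, rfl⟩ := Ideal.Quotient.mk_surjective z
    exact ⟨x, hunit, hlt, (Colombeau.pointValue_mk_eq_zero_iff U x hz).1 hz0⟩
  tfae_have 2 → 3 := fun h => Ideal.Quotient.eq_zero_iff_mem.2
    (hU.smoothWith_negligible hr fun k => (hcenter k).1 (h k))
  tfae_have 3 → 1 := by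
    intro h s hs
    -- Radius `min s r`: the point must be close to the center and also lie in the domain of `u`.
    obtain ⟨z, hunit, hz⟩ := Colombeau.exists_isUnit_sub_mem_sharpBall
      (Ideal.Quotient.mk Colombeau.negligibleNets c) (lt_min hs hr)
    have hz' : Colombeau.sharpNorm (z - Ideal.Quotient.mk Colombeau.negligibleNets c) < min s r := hz
    refine ⟨z, ⟨hz'.trans_le (min_le_right _ _), ?_⟩, hunit, hz'.trans_le (min_le_left _ _)⟩
    rw [h, map_zero]
  tfae_finish
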